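/- **Conventions.** Let $K$ be a finite field. A linear code $C\subseteq K^N$ is *minimal* if for all $c,c'\in C$ with $\mathrm{supp}(c')\subseteq\mathrm{supp}(c)$ there is $\lambda\in K$ with $c'=\lambda c$. For a finite set $\Omega$ of points of a projective space $\mathrm{PG}(W)$ over a finite field, $\mathcal C(\Omega)$ is the linear code whose generator matrix has as columns coordinate vectors of the points of $\Omega$; it is defined up to monomial equivalence, and its words are the evaluations of the linear functionals on $\Omega$. All vector spaces are finite-dimensional. **Theorem 1.3.** The following codes are minimal. 1. *Grassmann codes:* for a $K$-space $V$ and $1\le k\le \dim V-1$, the code $\mathcal C(\Omega)$ of $\Omega=\{[v_1\wedge\dots\wedge v_k] : \langle v_1,\dots,v_k\rangle \text{ a } k\text{-dimensional subspace of } V\}\subseteq \mathrm{PG}(\bigwedge^kV)$. 2. *Segre codes:* for $K$-spaces $V_1,V_2$, the code of $\{[p\otimes q] : 0\ne p\in V_1,\ 0\ne q\in V_2\}\subseteq\mathrm{PG}(V_1\otimes V_2)$. 3. *Line polar Grassmann codes,* for $|K|\neq 2$. Let $V$ be a $K$-space with a form of one of the types below, let $n$ be its Witt index (the largest dimension of a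 totally isotropic, respectively totally singular, subspace), and let $\Omega\subseteq\mathrm{PG}(\bigwedge^2V)$ be the set of points $[v\wedge w]$ for all two-dimensional totally isotropic (totally singular) subspaces $\langle v,w\rangle$ of $V$. Then $\mathcal C(\Omega)$ is minimal if the form is - (symplectic) a non-degenerate alternating bilinear form, and $n\ge 2$; - (orthogonal) a non-degenerate quadratic form, i.e. one with no non-zero singular vector in the radical of its polar form, and $n\ge 3$; - (Hermitian) a non-degenerate Hermitian form with respect to an automorphism of $K$ of order two, and $n\ge 3$. 4. *Codes from the point-hyperplane geometry:* let $\dim V=n+1$ with $n\ge 2$ and $(n,|K|)\ne(2,2)$. Let $\Gamma$ be the geometry whose points are the pairs $(p,H)$ of a point $p$ and a hyperplane $H$ of $\mathrm{PG}(V)$ with $p\in H$, and whose lines are the sets $\{(p,H): p\in r\}$ for a line $r$ contained in a hyperplane $H$, and the sets $\{(p,H) : S\subseteq H\}$ for a point $p$ contained in a subspace $S$ of codimension two. For every projective embedding $\varepsilon$ of $\Gamma$ into a projective space $\mathrm{PG}(W)$ over a finite field (an injective map from the points of $\Gamma$ to the points of $\mathrm{PG}(W)$ that maps every line of $\Gamma$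 onto a projective line and whose image spans $\mathrm{PG}(W)$), the code of the image of $\varepsilon$ is minimal. In particular, for every basis of $V$ and every automorphism $\sigma$ of $K$, with $\xi^\sigma$ obtained by applying $\sigma$ to the coordinates of $\xi\in V^*$ in the dual basis, the code of $\{[x\otimes\xi^\sigma] : 0\ne x\in V,\ 0\ne \xi\in V^*,\ \xi(x)=0\}\subseteq\mathrm{PG}(V\otimes V^*)$ (Segre embedding for $\sigma=1$, twisted embedding for $\sigma\neq1$) is minimal. -/

import Mathlib

open scoped TensorProduct LinearAlgebra.Projectivization

noncomputable section

namespace EmbCode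

section Codes

variable {K V : Type*} [Field K] [AddCommGroup V] [Module K V]

/-- `c` is a minimal codeword of the linear code `C ⊆ K^ι`: every codeword whose support is
contained in the support of `c` is a scalar multiple of `c`. -/
def IsMinimalCodeword {ι : Type*} (C : Submodule K (ι → K)) (c : ι → K) : Prop :=
  ∀ c' ∈ C, Function.support c' ⊆ Function.support c → ∃ a : K, c' = a • c

/-- A linear code is minimal if all its codewords are minimal. -/
def IsMinimalCode {ι : Type*} (C : Submodule K (ι → K)) : Prop :=
  ∀ c ∈ C, IsMinimalCodeword C c

/-- The set `[X]` of points of `PG(V)` represented by the non-zero vectors in `X`. -/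
def pointSet (X : Set V) : Set (ℙ K V) :=
  {P | ∃ (x : V) (hx : x ≠ 0), x ∈ X ∧ P = Projectivization.mk K x hx}

/-- The linear code of a projective system `Ω`. Its coordinate positions are the points of `Ω`;
the codeword of a linear functional `f` has entry `f x` at the point `P = [x]`, where `x` is a fixed
vector representing `P`. This is the row space of the matrix whose columns are coordinate vectors
of the points of `Ω`: another reference system of `PG(V)`, or of the span of `Ω`, gives the same
code (functionals on the span extend to `V`), and other representatives give a monomially
equivalent one. -/
def linearCode (Ω : Set (ℙ K V)) : Submodule K (Ω → K) :=
  LinearMap.range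
    (LinearMap.pi fun P : Ω => Module.Dual.eval K V (P : ℙ K V).rep :
      Module.Dual K V →ₗ[K] (Ω → K))

end Codes

section Grassmann

variable {K V : Type*} [Field K] [AddCommGroup V] [Module K V]

/-- The image under the Grassmann embedding `⟨v₁, …, v_k⟩ ↦ [v₁ ∧ ⋯ ∧ v_k]` of the set of all
`k`-dimensional subspaces of `V` with the property `S`. -/
def grassmannSystem (k : ℕ) (S : Submodule K V → Prop) : Set (ℙ K (⋀[K]^k V)) :=
  pointSet {w | ∃ v : Fin k → V, LinearIndependent K v ∧ S (Submodule.span K (Set.range v)) ∧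
    w = exteriorPower.ιMulti K k v}

variable (K V) in
/-- The Grassmann code: the code of the image of all `k`-dimensional subspaces of `V`. -/
def grassmannCode (k : ℕ) : Submodule K (grassmannSystem (K := K) (V := V) k (fun _ => True) → K) :=
  linearCode (grassmannSystem k fun _ => True)

/-- The polar Grassmann code: the code of the image of the `k`-dimensional totally isotropic
(totally singular) subspaces, these being the subspaces with the property `iso`. -/
def polarGrassmannCode (iso : Submodule K V → Prop) (k : ℕ) :
    Submodule K (grassmannSystem k iso → K) :=
  linearCode (grassmannSystem k iso)

/-- The Witt index: the largest dimension of a totally isotropic (totally singular) subspace. -/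
def wittIndex (iso : Submodule K V → Prop) : ℕ :=
  sSup {d | ∃ X : Submodule K V, iso X ∧ Module.finrank K X = d}

/-- `X` is totally isotropic for the alternating form `B`. -/
def AltIsotropic (B : LinearMap.BilinForm K V) (X : Submodule K V) : Prop :=
  ∀ x ∈ X, ∀ y ∈ X, B x y = 0

/-- `X` is totally singular for the quadratic form `Q`. -/
def QuadSingular (Q : QuadraticForm K V) (X : Submodule K V) : Prop :=
  ∀ x ∈ X, Q x = 0

/-- The quadratic form `Q` is non-degenerate (in every characteristic): no non-zero singular
vector lies in the radical of the polar bilinear form of `Q`. -/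
def QuadNondegenerate (Q : QuadraticForm K V) : Prop :=
  ∀ x : V, Q x = 0 → (∀ y : V, QuadraticMap.polar Q x y = 0) → x = 0

/-- `X` is totally isotropic for the `σ`-sesquilinear form `h`. -/
def HermIsotropic {σ : K ≃+* K} (h : V →ₛₗ[(σ : K →+* K)] V →ₗ[K] K) (X : Submodule K V) : Prop :=
  ∀ x ∈ X, ∀ y ∈ X, h x y = 0

/-- `h` is a non-degenerate Hermitian form with respect to `σ`, an automorphism of `K` of order
two. -/
structure IsHermitianForm (σ : K ≃+* K) (h : V →ₛₗ[(σ : K →+* K)] V →ₗ[K] K) : Prop where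
  ne_id : σ ≠ RingEquiv.refl K
  invol : ∀ a, σ (σ a) = a
  symm : ∀ x y, σ (h x y) = h y x
  nondeg : ∀ x, (∀ y, h x y = 0) → x = 0

end Grassmann

section Segre

variable (K V₁ V₂ : Type*) [Field K] [AddCommGroup V₁] [Module K V₁] [AddCommGroup V₂] [Module K V₂]

/-- The Segre variety: the set of points `[p ⊗ q]` of `PG(V₁ ⊗ V₂)`. -/
def segreVariety : Set (ℙ K (V₁ ⊗[K] V₂)) :=
  pointSet {w | ∃ (p : V₁) (q : V₂), p ≠ 0 ∧ q ≠ 0 ∧ w = p ⊗ₜ[K] q}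

/-- The Segre code. -/
def segreCode : Submodule K (segreVariety K V₁ V₂ → K) :=
  linearCode (segreVariety K V₁ V₂)

end Segre

section PointHyperplane

variable {F W : Type*} [Field F] [AddCommGroup W] [Module F W]

/-- `ε` is a projective embedding into `PG(W)` of the point-line geometry with point set `P` and
line set `L`: it is injective, maps every line onto a projective line, and its image
spans `PG(W)`. -/
structure IsProjectiveEmbedding {P : Type*} (L : Set (Set P)) (ε : P → ℙ F W) : Prop where
  injective : Function.Injective ε
  map_line : ∀ l ∈ L, ∃ T : Submodule F W, Module.finrank F T = 2 ∧
    ε '' l = {x | x.submodule ≤ T}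
  span : ⨆ p, (ε p).submodule = ⊤

variable (K V : Type*) [Field K] [AddCommGroup V] [Module K V]

/-- The points of the point-hyperplane geometry of `PG(V)`: the pairs `(p, H)` of a point `p` and a
hyperplane `H` of `PG(V)` with `p ∈ H`. -/
def PHPoint : Type _ :=
  {x : ℙ K V × Submodule K V // IsCoatom x.2 ∧ x.1.submodule ≤ x.2}

/-- The lines of the point-hyperplane geometry of `PG(V)`: for a line `r` of `PG(V)` contained in a
hyperplane `H`, the set of all `(p, H)` with `p ∈ r`; for a point `p` contained in a subspace `S`
of codimension two, the set of all `(p, H)` with `S ⊆ H`. -/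
def phLines : Set (Set (PHPoint K V)) :=
  {l | ∃ r H : Submodule K V, Module.finrank K r = 2 ∧ IsCoatom H ∧ r ≤ H ∧
      l = {x | x.1.1.submodule ≤ r ∧ x.1.2 = H}} ∪
  {l | ∃ (p : ℙ K V) (S : Submodule K V), Module.finrank K (V ⧸ S) = 2 ∧ p.submodule ≤ S ∧
      l = {x | x.1.1 = p ∧ S ≤ x.1.2}}

variable {K V}

/-- `v^σ`: the field automorphism `σ` applied to the coordinates of `v` in the basis `b`. -/
def coordTwist {n : ℕ} (b : Module.Basis (Fin n) K V) (σ : K ≃+* K) (v : V) : V :=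
  ∑ i, σ (b.repr v i) • b i

/-- The point set `{[x ⊗ ξ^σ] : [x] ∈ [ker ξ]}`, the image of the Segre embedding (`σ = 1`) or of a
twisted embedding (`σ ≠ 1`) of the point-hyperplane geometry; `ξ^σ` is taken with respect to the
dual of the basis `b`. -/
def phSystem {n : ℕ} (b : Module.Basis (Fin n) K V) (σ : K ≃+* K) :
    Set (ℙ K (V ⊗[K] Module.Dual K V)) :=
  pointSet {w | ∃ (x : V) (ξ : Module.Dual K V), x ≠ 0 ∧ ξ ≠ 0 ∧ ξ x = 0 ∧
    w = x ⊗ₜ[K] coordTwist b.dualBasis σ ξ}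

end PointHyperplane

end EmbCode

end

/-! Codewords are functionals, so minimality of the code of `Ω` means: if `g` vanishes at every
point of `Ω` where `f` does, then `g` is a multiple of `f` on `Ω`. For Grassmann and Segre codes,
`f` and `g` become multilinear forms such that zeros of `f` are zeros of `g`. Freezing one argument
leaves proportional forms, and a linear map that is pointwise a multiple of another one is a
multiple of it (`exists_eq_smul_of_pointwise`).

In the other cases the ratio `g / f` is locally constant where `f ≠ 0`, and the work is to prove
that this part of the geometry is connected.

Polar lines. `f` and `g` become alternating forms. For singular `x` the functionals `f x` and `g x`
are proportional on the singular vectors of the perp of `x`, with factor `c x`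
(`TS.exists_eq_mul_on_residue`), and `c x = c y` if `x ⊥ y` and `f x y ≠ 0`. Call `x` good if it has
such a neighbour `y`. Non-orthogonal good vectors have a common neighbour
(`TS.exists_common_neighbour`). Orthogonal ones are linked through a good vector orthogonal to
neither (`TS.exists_good_not_perp`): at a vector that is not good, `f` is a multiple of the polar
form, so a totally singular line cannot have exactly one good point (`TS.not_good_of_line`). In the
symplectic case every vector is singular, perps are subspaces, and the same scheme is shorter.

Point-hyperplane flags. The flags on a fixed point, or on a fixed hyperplane, form a projective
space, in which the zeros of `f` are a hyperplane or everything: `ξ (b x) = 0` for a vector `b x`,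
and `a ξ x = 0` for a functional `a ξ`. Off the zeros of `f` the ratio is constant in each of these
spaces. Points `x`, `y` are linked by a common hyperplane unless `b x` or `b y` lies in their span;
the exceptional case is settled by a count (`FlagLabelling.sameLabel_of_mem`) that needs a third
scalar or a fourth dimension. -/

namespace EmbCode

/-! ### Proportionality of linear and multilinear forms -/

section LinearAlgebra

variable {K V Y : Type*} [Field K] [AddCommGroup V] [Module K V] [AddCommGroup Y] [Module K Y]

theorem exists_eq_mul_of_forall_mem (S : Submodule K V) (a b : Module.Dual K V)
    (h : ∀ v ∈ S, a v = 0 → b v = 0) : ∃ c : K, ∀ v ∈ S, b v = c * a v := by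
  by_cases h0 : ∃ v ∈ S, a v ≠ 0
  · obtain ⟨w, hw, hw0⟩ := h0
    refine ⟨b w / a w, fun v hv => ?_⟩
    have := h (a w • v - a v • w) (S.sub_mem (S.smul_mem _ hv) (S.smul_mem _ hw))
      (by simp [mul_comm])
    simp only [map_sub, map_smul, smul_eq_mul] at this
    field_simp
    linear_combination this
  · push Not at h0
    exact ⟨0, fun v hv => by rw [h v hv (h0 v hv), zero_mul]⟩

theorem exists_eq_smul_of_ker_le (a b : Module.Dual K V) (h : ∀ v, a v = 0 → b v = 0) :
    ∃ c : K, b = c • a := by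
  obtain ⟨c, hc⟩ := exists_eq_mul_of_forall_mem ⊤ a b fun v _ => h v
  exact ⟨c, LinearMap.ext fun v => hc v trivial⟩

/-- A linear map that is pointwise a multiple of another one is a multiple of it. -/
theorem exists_eq_smul_of_pointwise (F G : V →ₗ[K] Y) (h : ∀ e, ∃ c : K, G e = c • F e) :
    ∃ c : K, G = c • F := by
  by_cases h0 : ∃ e, F e ≠ 0
  · obtain ⟨e₀, h0⟩ := h0
    obtain ⟨c, hc⟩ := h e₀
    refine ⟨c, LinearMap.ext fun e => ?_⟩
    rw [LinearMap.smul_apply]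
    -- If `F e` is a multiple of `F e₀`, subtract to land in the kernel of `F`, hence of `G`.
    -- Otherwise `F e` and `F e₀` are independent, and `e + e₀` forces the factors at `e` and `e₀`
    -- to agree.
    by_cases hd : ∃ t : K, F e = t • F e₀
    · obtain ⟨t, ht⟩ := hd
      obtain ⟨d, hd⟩ := h (e - t • e₀)
      rw [map_sub, map_sub, map_smul, map_smul, ht, sub_self, smul_zero, sub_eq_zero] at hd
      rw [hd, hc, ht, smul_comm]
    · obtain ⟨d, hd'⟩ := h e
      obtain ⟨k, hk⟩ := h (e + e₀)
      rw [map_add, map_add, hd', hc, smul_add] at hk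
      have key : (d - k) • F e = (k - c) • F e₀ := by
        rw [sub_smul, sub_smul, sub_eq_sub_iff_add_eq_add, hk, add_comm]
      have hdk : d = k := by
        by_contra hne
        refine hd ⟨(d - k)⁻¹ * (k - c), ?_⟩
        rw [mul_smul, ← key, inv_smul_smul₀ (sub_ne_zero.2 hne)]
      rw [hdk, sub_self, zero_smul, eq_comm, smul_eq_zero] at key
      rw [hd', hdk, sub_eq_zero.1 (key.resolve_right h0)]
  · push Not at h0
    refine ⟨0, LinearMap.ext fun e => ?_⟩
    obtain ⟨c, hc⟩ := h e
    rw [hc, h0, smul_zero, zero_smul, LinearMap.zero_apply]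

/-- Induction on the number of arguments: with the first argument fixed, the forms are proportional
by induction, so the curried maps are pointwise proportional. -/
theorem exists_eq_smul_multilinear {n : ℕ} {M : Fin n → Type*} [∀ i, AddCommGroup (M i)]
    [∀ i, Module K (M i)] (f g : MultilinearMap K M K) (h : ∀ v, f v = 0 → g v = 0) :
    ∃ c : K, g = c • f := by
  induction n with
  | zero =>
    refine ⟨g 0 / f 0, MultilinearMap.ext fun v => ?_⟩
    obtain rfl : v = 0 := Subsingleton.elim _ _
    rw [_root_.smul_apply, smul_eq_mul]
    by_cases h0 : f 0 = 0
    · rw [h0, h 0 h0, mul_zero]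
    · field_simp
  | succ n ih =>
    obtain ⟨c, hc⟩ := exists_eq_smul_of_pointwise f.curryLeft g.curryLeft fun e =>
      ih (f.curryLeft e) (g.curryLeft e) fun v hv => h _ hv
    refine ⟨c, MultilinearMap.ext fun v => ?_⟩
    have := congrArg (fun k => k (v 0) (Fin.tail v)) hc
    simpa using this

/-- A space on which neither of two functionals vanishes has a vector on which both are
non-zero. -/
theorem exists_ne_zero_and_ne_zero (S : Submodule K V) {a b : V → K}
    (ha : ∀ v w, a (v + w) = a v + a w) (hb : ∀ v w, b (v + w) = b v + b w) {v w : V}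
    (hv : v ∈ S) (hw : w ∈ S) (hav : a v ≠ 0) (hbw : b w ≠ 0) :
    ∃ u ∈ S, a u ≠ 0 ∧ b u ≠ 0 := by
  by_cases h1 : b v = 0
  · by_cases h2 : a w = 0
    · exact ⟨v + w, S.add_mem hv hw, by simpa [ha, h2], by simpa [hb, h1]⟩
    · exact ⟨w, hw, h2, hbw⟩
  · exact ⟨v, hv, hav, h1⟩

end LinearAlgebra

/-! ### Minimality in terms of functionals; Grassmann and Segre codes -/

section Codes

variable {K V : Type*} [Field K] [AddCommGroup V] [Module K V]

theorem isMinimalCode_linearCode {Ω : Set (ℙ K V)}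
    (h : ∀ f g : Module.Dual K V, (∀ P ∈ Ω, f P.rep = 0 → g P.rep = 0) →
      ∃ c : K, ∀ P ∈ Ω, g P.rep = c * f P.rep) : IsMinimalCode (linearCode Ω) := by
  rintro _ ⟨f, rfl⟩ _ ⟨g, rfl⟩ hs
  obtain ⟨c, hc⟩ := h f g fun P hP hf => by
    by_contra hg
    exact hs (show (⟨P, hP⟩ : Ω) ∈ _ from hg) hf
  exact ⟨c, funext fun P => hc P P.2⟩

/-- Replacing a representative scales both functionals by the same unit, so zeros and ratios may be
tested on any vectors spanning the points. -/
theorem isMinimalCode_pointSet {X : Set V}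
    (h : ∀ f g : Module.Dual K V, (∀ x ∈ X, f x = 0 → g x = 0) →
      ∃ c : K, ∀ x ∈ X, g x = c * f x) :
    IsMinimalCode (linearCode (pointSet (K := K) X)) := by
  refine isMinimalCode_linearCode fun f g hfg => ?_
  have key : ∀ x ∈ X, ∀ hx : x ≠ 0, ∃ a : Kˣ, a • x = (Projectivization.mk K x hx).rep :=
    fun x _ hx => Projectivization.exists_smul_eq_mk_rep K x hx
  obtain ⟨c, hc⟩ := h f g fun x hx hf => by
    by_cases hx0 : x = 0
    · rw [hx0, map_zero]
    obtain ⟨a, ha⟩ := key x hx hx0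
    have := hfg (Projectivization.mk K x hx0) ⟨x, hx0, hx, rfl⟩
    rw [← ha, Units.smul_def, map_smul, map_smul, hf, smul_zero] at this
    simpa using this rfl
  refine ⟨c, ?_⟩
  rintro _ ⟨x, hx0, hx, rfl⟩
  obtain ⟨a, ha⟩ := key x hx hx0
  rw [← ha, Units.smul_def, map_smul, map_smul, hc x hx, smul_eq_mul, smul_eq_mul, mul_left_comm]

theorem isMinimalCode_grassmannCode (k : ℕ) : IsMinimalCode (grassmannCode K V k) := by
  refine isMinimalCode_pointSet fun f g hfg => ?_
  let A (f : Module.Dual K (⋀[K]^k V)) : V [⋀^Fin k]→ₗ[K] K :=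
    f.compAlternatingMap (exteriorPower.ιMulti K k)
  obtain ⟨c, hc⟩ := exists_eq_smul_multilinear (A f).toMultilinearMap (A g).toMultilinearMap
    fun v hv => by
      -- Dependent tuples give no point of the system, but alternating forms vanish on them anyway.
      by_cases hli : LinearIndependent K v
      · exact hfg _ ⟨v, hli, trivial, rfl⟩ hv
      · exact (A g).map_linearDependent v hli
  refine ⟨c, ?_⟩
  rintro _ ⟨v, -, -, rfl⟩
  exact congrArg (fun m : MultilinearMap K (fun _ : Fin k => V) K => m v) hc

theorem isMinimalCode_segreCode (V₁ V₂ : Type*) [AddCommGroup V₁] [Module K V₁] [AddCommGroup V₂]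
    [Module K V₂] : IsMinimalCode (segreCode K V₁ V₂) := by
  refine isMinimalCode_pointSet fun f g hfg => ?_
  obtain ⟨c, hc⟩ := exists_eq_smul_of_pointwise (TensorProduct.curry f) (TensorProduct.curry g)
    fun p => exists_eq_smul_of_ker_le _ _ fun q hq => by
      by_cases hp0 : p = 0
      · simp [hp0]
      by_cases hq0 : q = 0
      · simp [hq0]
      exact hfg _ ⟨p, q, hp0, hq0, rfl⟩ hq
  refine ⟨c, ?_⟩
  rintro _ ⟨p, q, -, -, rfl⟩
  exact congrArg (fun m : V₁ →ₗ[K] V₂ →ₗ[K] K => m p q) hc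

/-- Minimality of a polar line Grassmann code in terms of pairs of alternating forms. -/
theorem isMinimalCode_polarGrassmannCode_two {iso : Submodule K V → Prop} {r : V → V → Prop}
    (hiso : ∀ x y, iso (Submodule.span K {x, y}) ↔ r x y)
    (h : ∀ f g : LinearMap.BilinForm K V, f.IsAlt → g.IsAlt →
      (∀ x y, r x y → f x y = 0 → g x y = 0) → ∃ c : K, ∀ x y, r x y → g x y = c * f x y) :
    IsMinimalCode (polarGrassmannCode iso 2) := by
  refine isMinimalCode_pointSet fun f g hfg => ?_
  let A (f : Module.Dual K (⋀[K]^2 V)) : V [⋀^Fin 2]→ₗ[K] K :=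
    f.compAlternatingMap (exteriorPower.ιMulti K 2)
  have up0 (a b c : V) : Function.update ![a, b] 0 c = ![c, b] := by
    funext i; fin_cases i <;> rfl
  have up1 (a b c : V) : Function.update ![a, b] 1 c = ![a, c] := by
    funext i; fin_cases i <;> rfl
  have hA1 (m : V [⋀^Fin 2]→ₗ[K] K) (x x' y : V) : m ![x + x', y] = m ![x, y] + m ![x', y] := by
    have := m.map_update_add ![0, y] 0 x x'
    simpa only [up0] using this
  have hA2 (m : V [⋀^Fin 2]→ₗ[K] K) (x y y' : V) : m ![x, y + y'] = m ![x, y] + m ![x, y'] := by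
    have := m.map_update_add ![x, 0] 1 y y'
    simpa only [up1] using this
  have hA3 (m : V [⋀^Fin 2]→ₗ[K] K) (a : K) (x y : V) : m ![a • x, y] = a • m ![x, y] := by
    have := m.map_update_smul ![0, y] 0 a x
    simpa only [up0] using this
  have hA4 (m : V [⋀^Fin 2]→ₗ[K] K) (a : K) (x y : V) : m ![x, a • y] = a • m ![x, y] := by
    have := m.map_update_smul ![x, 0] 1 a y
    simpa only [up1] using this
  let B (f : Module.Dual K (⋀[K]^2 V)) : LinearMap.BilinForm K V :=
    LinearMap.mk₂ K (fun x y => A f ![x, y]) (hA1 _) (hA3 _) (hA2 _) (hA4 _)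
  have hB (f) : (B f).IsAlt := fun x => (A f).map_eq_zero_of_eq ![x, x] (i := 0) (j := 1) rfl
    (by decide)
  obtain ⟨c, hc⟩ := h (B f) (B g) (hB f) (hB g) fun x y hr hf => by
    by_cases hli : LinearIndependent K ![x, y]
    · refine hfg _ ⟨![x, y], hli, ?_, rfl⟩ hf
      rw [Matrix.range_cons, Matrix.range_cons, Matrix.range_empty, Set.union_empty]
      exact (hiso x y).2 hr
    · exact (A g).map_linearDependent _ hli
  refine ⟨c, ?_⟩
  rintro _ ⟨v, -, hv, rfl⟩
  have hvv : v = ![v 0, v 1] := by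
    funext i; fin_cases i <;> rfl
  have hr : r (v 0) (v 1) := by
    rw [← hiso]
    rw [hvv, Matrix.range_cons, Matrix.range_cons, Matrix.range_empty, Set.union_empty] at hv
    exact hv
  have := hc _ _ hr
  rw [hvv]
  exact this

end Codes

/-! ### Polar spaces: hyperbolic pairs and residues -/

/-- A common frame for the polar spaces of quadratic and Hermitian forms: a reflexive sesquilinear
form, together with its singular vectors. -/
structure PolarForm (K V : Type*) [Field K] [AddCommGroup V] [Module K V] where
  form : V → Module.Dual K V
  twist : K ≃+* K
  sing : V → Prop
  form_add : ∀ x y, form (x + y) = form x + form y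
  form_smul : ∀ (a : K) x, form (a • x) = twist a • form x
  form_symm : ∀ {x y}, form x y = 0 → form y x = 0
  form_self : ∀ {x}, sing x → form x x = 0
  sing_comb : ∀ {x y} (a b : K), sing x → sing y → form x y = 0 → sing (a • x + b • y)
  eq_zero : ∀ {x}, sing x → (∀ y, form x y = 0) → x = 0
  exists_sing_add : ∀ {v w}, sing w → form v w ≠ 0 → ∃ a : K, sing (v + a • w)
  -- This is the identity met when scalars are compared along a totally singular line in
  -- `TS.not_good_of_line`. For the trivial twist it amounts to the existence of a scalar other than
  -- 0 and 1.
  twist_sep : ∀ c d : K, (∀ t, t * (twist t - 1) * c = twist t * (t - 1) * d) → c = d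

namespace PolarForm

variable {K V : Type*} [Field K] [AddCommGroup V] [Module K V] (P : PolarForm K V)

theorem form_comm_ne {x y : V} (h : P.form x y ≠ 0) : P.form y x ≠ 0 :=
  fun h' => h (P.form_symm h')

theorem form_add_apply (x y z : V) : P.form (x + y) z = P.form x z + P.form y z := by
  rw [P.form_add, LinearMap.add_apply]

theorem form_smul_apply (a : K) (x z : V) : P.form (a • x) z = P.twist a * P.form x z := by
  rw [P.form_smul, LinearMap.smul_apply, smul_eq_mul]

theorem sing_add {x y : V} (hx : P.sing x) (hy : P.sing y) (h : P.form x y = 0) :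
    P.sing (x + y) := by
  simpa using P.sing_comb 1 1 hx hy h

theorem sing_add_smul {x y : V} (b : K) (hx : P.sing x) (hy : P.sing y) (h : P.form x y = 0) :
    P.sing (x + b • y) := by
  simpa using P.sing_comb 1 b hx hy h

/-- Totally singular subspaces. -/
def TS (U : Submodule K V) : Prop := ∀ x ∈ U, ∀ y ∈ U, P.sing x ∧ P.form x y = 0

variable {P}

theorem exists_form_ne_zero {x : V} (hx : P.sing x) (h0 : x ≠ 0) : ∃ y, P.form x y ≠ 0 := by
  by_contra! h
  exact h0 (P.eq_zero hx h)

/-- Projecting a vector to the perp of a hyperbolic pair. -/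
theorem exists_perp_pair {x y : V} (hx : P.sing x) (hy : P.sing y) (hxy : P.form x y ≠ 0) (v : V) :
    ∃ a b : K, P.form x (v + a • x + b • y) = 0 ∧ P.form y (v + a • x + b • y) = 0 := by
  have hyx := P.form_comm_ne hxy
  refine ⟨-(P.form y v / P.form y x), -(P.form x v / P.form x y), ?_, ?_⟩
  · simp only [map_add, map_smul, smul_eq_mul, P.form_self hx]
    field_simp
    ring
  · simp only [map_add, map_smul, smul_eq_mul, P.form_self hy]
    field_simp
    ring

/-- A vector not orthogonal to a singular vector `u` can be made singular by adding a multiple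
of `u`. -/
theorem exists_partner {u v : V} (hu : P.sing u) (h : P.form u v ≠ 0) :
    ∃ a : K, P.sing (v + a • u) ∧ P.form u (v + a • u) ≠ 0 := by
  obtain ⟨a, ha⟩ := P.exists_sing_add hu (P.form_comm_ne h)
  exact ⟨a, ha, by simpa [P.form_self hu] using h⟩

theorem TS.mono {U U' : Submodule K V} (h : P.TS U) (h' : U' ≤ U) : P.TS U' :=
  fun x hx y hy => h x (h' hx) y (h' hy)

theorem exists_ne_zero_of_finrank {U : Submodule K V} (h : 1 ≤ Module.finrank K U) :
    ∃ u ∈ U, u ≠ 0 := by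
  refine U.exists_mem_ne_zero_of_ne_bot ?_
  rintro rfl
  rw [finrank_bot] at h
  omega

/-- Moving two singular vectors by the vectors of a hyperbolic pair to make them orthogonal. -/
theorem exists_smul_perp {y z u u' : V} (hyu' : P.form y u' = 0) (hzu : P.form z u = 0)
    (h : P.form u u' ≠ 0) : ∃ b : K, P.form (y + u) (z + b • u') = 0 := by
  refine ⟨-(P.form y z / P.form u u'), ?_⟩
  rw [P.form_add_apply, map_add, map_add, map_smul, map_smul, hyu', P.form_symm hzu]
  simp only [smul_eq_mul]
  field_simp
  ring

variable [FiniteDimensional K V]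

theorem finrank_le_inf_ker (U : Submodule K V) (f : Module.Dual K V) :
    Module.finrank K U ≤ Module.finrank K (U ⊓ LinearMap.ker f : Submodule K V) + 1 := by
  have h1 := Submodule.finrank_sup_add_finrank_inf_eq U (LinearMap.ker f)
  have h2 := (U ⊔ LinearMap.ker f).finrank_le
  have h3 := f.finrank_range_add_finrank_ker
  have h4 := (LinearMap.range f).finrank_le
  rw [Module.finrank_self] at h4
  omega

/-- Every singular vector lies in totally singular subspaces of the largest dimension. -/
theorem TS.exists_mem {U : Submodule K V} (hU : P.TS U) {x : V} (hx : P.sing x) :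
    ∃ U', P.TS U' ∧ x ∈ U' ∧ Module.finrank K U ≤ Module.finrank K U' ∧
      U ⊓ LinearMap.ker (P.form x) ≤ U' ∧ U' ≤ U ⊔ K ∙ x := by
  by_cases hxU : x ∈ U
  · exact ⟨U, hU, hxU, le_rfl, inf_le_left, le_sup_left⟩
  -- Passing to the perp of `x` loses at most one dimension, and adjoining `x` regains it.
  refine ⟨(U ⊓ LinearMap.ker (P.form x)) ⊔ K ∙ x, ?_,
    Submodule.mem_sup_right (Submodule.mem_span_singleton_self x), ?_, le_sup_left,
    sup_le_sup_right inf_le_left _⟩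
  · intro v hv w hw
    obtain ⟨v', ⟨hv', hv''⟩, a, ha, rfl⟩ := Submodule.mem_sup.1 hv
    obtain ⟨w', ⟨hw', hw''⟩, b, hb, rfl⟩ := Submodule.mem_sup.1 hw
    obtain ⟨a, rfl⟩ := Submodule.mem_span_singleton.1 ha
    obtain ⟨b, rfl⟩ := Submodule.mem_span_singleton.1 hb
    have hv'' : P.form x v' = 0 := hv''
    have hw'' : P.form x w' = 0 := hw''
    refine ⟨P.sing_add_smul a (hU _ hv' _ hv').1 hx (P.form_symm hv''), ?_⟩
    rw [P.form_add_apply, map_add, map_add, map_smul, map_smul, P.form_smul_apply,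
      P.form_smul_apply, (hU _ hv' _ hw').2, P.form_symm hv'', hw'', P.form_self hx]
    simp
  · rw [Submodule.finrank_sup_span_singleton fun h => hxU (Submodule.mem_inf.1 h).1]
    exact finrank_le_inf_ker U _

/-- `x` is put into the subspace first, so orthogonality to `x` is free and only the perp of `y`
costs a dimension. -/
theorem TS.exists_perp {U : Submodule K V} (hU : P.TS U) {x y : V} (hx : P.sing x) :
    ∃ U', P.TS U' ∧ U' ≤ U ⊔ K ∙ x ∧ (∀ u ∈ U', P.form x u = 0 ∧ P.form y u = 0) ∧
      Module.finrank K U ≤ Module.finrank K U' + 1 := by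
  obtain ⟨U₁, h1, hxU, hr, -, hle⟩ := hU.exists_mem hx
  exact ⟨U₁ ⊓ LinearMap.ker (P.form y), h1.mono inf_le_left, inf_le_left.trans hle,
    fun u hu => ⟨(h1 x hxU u hu.1).2, hu.2⟩, hr.trans (finrank_le_inf_ker U₁ _)⟩

/-- In rank at least three the perp of two orthogonal hyperbolic pairs contains a hyperbolic
pair. -/
theorem TS.exists_hyperbolic {U : Submodule K V} (hU : P.TS U) (hr : 3 ≤ Module.finrank K U)
    {x y z w : V} (hx : P.sing x) (hy : P.sing y) (hz : P.sing z) (hw : P.sing w)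
    (hxy : P.form x y ≠ 0) (hzw : P.form z w ≠ 0) (hxz : P.form x z = 0) (hxw : P.form x w = 0)
    (hyz : P.form y z = 0) (hyw : P.form y w = 0) :
    ∃ u u', P.sing u ∧ P.sing u' ∧ P.form u u' ≠ 0 ∧
      (P.form x u = 0 ∧ P.form y u = 0 ∧ P.form z u = 0 ∧ P.form w u = 0) ∧
      (P.form x u' = 0 ∧ P.form y u' = 0 ∧ P.form z u' = 0 ∧ P.form w u' = 0) := by
  -- Each hyperbolic pair costs one dimension, so rank three leaves a non-zero `u`. The second step
  -- only adds multiples of `z`, which is orthogonal to `x` and `y`, so the first perp is kept.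
  obtain ⟨U₁, h1, -, hp1, hr1⟩ := hU.exists_perp (y := y) hx
  obtain ⟨U₂, h2, hle, hp2, hr2⟩ := h1.exists_perp (y := w) hz
  obtain ⟨u, hu, hu0⟩ := exists_ne_zero_of_finrank (U := U₂) (by omega)
  have hus := (h2 u hu u hu).1
  have hxu : P.form x u = 0 ∧ P.form y u = 0 := by
    obtain ⟨v, hv, c, hc, rfl⟩ := Submodule.mem_sup.1 (hle hu)
    obtain ⟨c, rfl⟩ := Submodule.mem_span_singleton.1 hc
    simp [hp1 v hv, hxz, hyz]
  obtain ⟨hzu, hwu⟩ := hp2 u hu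
  obtain ⟨v, hv⟩ := exists_form_ne_zero hus hu0
  obtain ⟨a, b, h3, h4⟩ := exists_perp_pair hx hy hxy v
  set v' := v + a • x + b • y with hv'
  obtain ⟨c, d, h5, h6⟩ := exists_perp_pair hz hw hzw v'
  have h7 : P.form u (v' + c • z + d • w) ≠ 0 := by
    rw [hv']
    simpa [P.form_symm hxu.1, P.form_symm hxu.2, P.form_symm hzu, P.form_symm hwu] using hv
  obtain ⟨e, h8, h9⟩ := exists_partner hus h7
  refine ⟨u, _, hus, h8, h9, ⟨hxu.1, hxu.2, hzu, hwu⟩, ?_, ?_, ?_, ?_⟩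
  · rw [map_add, map_add, map_add, h3]; simp [hxz, hxw, hxu]
  · rw [map_add, map_add, map_add, h4]; simp [hyz, hyw, hxu]
  · rw [map_add, h5]; simp [hzu]
  · rw [map_add, h6]; simp [hwu]

/-- Two functionals, one of which vanishes on a hyperplane section of the residue of a singular
vector whenever the other one does, are proportional there. -/
theorem TS.exists_eq_mul_on_residue {U : Submodule K V} (hU : P.TS U)
    (hr : 3 ≤ Module.finrank K U) {x : V} (hx : P.sing x) (hx0 : x ≠ 0) (a b : Module.Dual K V)
    (hab : ∀ y, P.sing y → P.form x y = 0 → a y = 0 → b y = 0) :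
    ∃ c : K, ∀ y, P.sing y → P.form x y = 0 → b y = c * a y := by
  have perp : ∀ y z, P.sing y → P.sing z → P.form x y = 0 → P.form x z = 0 → P.form y z = 0 →
      b y * a z = b z * a y := by
    intro y z hy hz hxy hxz hyz
    -- This combination is singular because `y ⊥ z`, and `a` kills it.
    have := hab (a z • y + (-a y) • z) (P.sing_comb _ _ hy hz hyz) (by simp [hxy, hxz])
      (by simp [mul_comm])
    simp only [map_add, map_smul, smul_eq_mul] at this
    linear_combination this
  have trans : ∀ y w z, a w ≠ 0 → b y * a w = b w * a y → b w * a z = b z * a w →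
      b y * a z = b z * a y := by
    intro y w z hw h1 h2
    refine mul_right_cancel₀ hw ?_
    linear_combination a z * h1 + a y * h2
  have key : ∀ y z, P.sing y → P.sing z → P.form x y = 0 → P.form x z = 0 → a y ≠ 0 → a z ≠ 0 →
      b y * a z = b z * a y := by
    intro y z hy hz hxy hxz hay haz
    by_cases hyz : P.form y z = 0
    · exact perp y z hy hz hxy hxz hyz
    obtain ⟨v, hv⟩ := exists_form_ne_zero hx hx0
    obtain ⟨c, d, h1, h2⟩ := exists_perp_pair hy hz hyz v
    obtain ⟨e, h3, h4⟩ := exists_partner (v := v + c • y + d • z) hx (by simpa [hxy, hxz] using hv)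
    -- `y` and `z` are joined by a chain of consecutively orthogonal vectors off the kernel of `a`:
    -- through `u` or `u'` if `a` is non-zero there, and otherwise through `y + u` and `z + β • u'`,
    -- where `a` has the values `a y` and `a z`.
    obtain ⟨u, u', hu, hu', huu, ⟨hxu, -, hyu, hzu⟩, hxu', -, hyu', hzu'⟩ :=
      hU.exists_hyperbolic hr hx h3 hy hz h4 hyz hxy hxz
        (P.form_symm (by rw [map_add, h1]; simp [P.form_symm hxy]))
        (P.form_symm (by rw [map_add, h2]; simp [P.form_symm hxz]))
    by_cases hau : a u = 0
    · by_cases hau' : a u' = 0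
      · obtain ⟨β, hβ⟩ := exists_smul_perp (y := y) hyu' hzu huu
        have s1 := P.sing_add hy hu hyu
        have s2 := P.sing_add_smul β hz hu' hzu'
        have e1 : P.form x (y + u) = 0 := by simp [hxy, hxu]
        have e2 : P.form x (z + β • u') = 0 := by simp [hxz, hxu']
        refine trans y (y + u) z (by simpa [hau]) ?_
          (trans _ (z + β • u') _ (by simpa [hau']) ?_ ?_)
        · exact perp _ _ hy s1 hxy e1 (by simp [P.form_self hy, hyu])
        · exact perp _ _ s1 s2 e1 e2 hβ
        · exact perp _ _ s2 hz e2 hxz (P.form_symm (by simp [P.form_self hz, hzu']))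
      · exact trans y u' z hau' (perp _ _ hy hu' hxy hxu' hyu')
          (perp _ _ hu' hz hxu' hxz (P.form_symm hzu'))
    · exact trans y u z hau (perp _ _ hy hu hxy hxu hyu)
          (perp _ _ hu hz hxu hxz (P.form_symm hzu))
  by_cases h0 : ∃ y, P.sing y ∧ P.form x y = 0 ∧ a y ≠ 0
  · obtain ⟨y, hy, hxy, hay⟩ := h0
    refine ⟨b y / a y, fun z hz hxz => ?_⟩
    by_cases haz : a z = 0
    · rw [haz, hab z hz hxz haz, mul_zero]
    · have := key y z hy hz hxy hxz hay haz
      field_simp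
      linear_combination -this
  · push Not at h0
    exact ⟨0, fun z hz hxz => by rw [hab z hz hxz (h0 z hz hxz), zero_mul]⟩

/-- A functional that vanishes on the singular vectors of the perp of a singular vector vanishes on
this perp. -/
theorem TS.eq_zero_of_perp {U : Submodule K V} (hU : P.TS U) (hr : 3 ≤ Module.finrank K U) {z : V}
    (hz : P.sing z) (hz0 : z ≠ 0) (a : Module.Dual K V)
    (ha : ∀ w, P.sing w → P.form z w = 0 → a w = 0) {v : V} (hv : P.form z v = 0) : a v = 0 := by
  -- A vector of the perp of `z` that is not orthogonal to a singular `u` of this perp becomes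
  -- singular on adding a multiple of `u`.
  have aux : ∀ u v, P.sing u → P.form z u = 0 → P.form z v = 0 → P.form u v ≠ 0 → a v = 0 := by
    intro u v hu hzu hzv huv
    obtain ⟨c, hc, -⟩ := exists_partner hu huv
    have := ha _ hc (by simp [hzv, hzu])
    simpa [ha u hu hzu] using this
  obtain ⟨v₁, h1⟩ := exists_form_ne_zero hz hz0
  obtain ⟨c, h2, h3⟩ := exists_partner hz h1
  obtain ⟨U', hU', -, hp, hr'⟩ := hU.exists_perp (y := v₁ + c • z) hz
  obtain ⟨u, hu, hu0⟩ := exists_ne_zero_of_finrank (U := U') (by omega)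
  have hus := (hU' u hu u hu).1
  obtain ⟨w, hw⟩ := exists_form_ne_zero hus hu0
  obtain ⟨d, e, h5, -⟩ := exists_perp_pair hz h2 h3 w
  -- If `u ⊥ v`, write `v` as the difference of `v + w'` and `w'`, neither orthogonal to `u`.
  by_cases huv : P.form u v = 0
  · set w' := w + d • z + e • (v₁ + c • z) with hw'
    have h7 : P.form u w' ≠ 0 := by
      have h8 : P.form u z = 0 := P.form_symm (hp u hu).1
      have h9 : P.form u (v₁ + c • z) = 0 := P.form_symm (hp u hu).2
      rw [hw', map_add, map_smul _ e, h9]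
      simpa [h8] using hw
    have h8 := aux u w' hus (hp u hu).1 h5 h7
    have h9 := aux u (v + w') hus (hp u hu).1 (by rw [map_add, hv, h5, add_zero])
      (by rwa [map_add, huv, zero_add])
    rwa [map_add, h8, add_zero] at h9
  · exact aux u v hus (hp u hu).1 hv huv

end PolarForm

/-! ### Polar spaces: good vectors and connectedness -/

namespace PolarForm

variable {K V : Type*} [Field K] [AddCommGroup V] [Module K V] {P : PolarForm K V}

/-- `x` spans, with some orthogonal singular vector, a line on which `f` does not vanish. -/
def Good (P : PolarForm K V) (f : LinearMap.BilinForm K V) (x : V) : Prop :=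
  ∃ u, P.sing u ∧ P.form x u = 0 ∧ f x u ≠ 0

theorem Good.ne_zero {f : LinearMap.BilinForm K V} {x : V} (h : P.Good f x) : x ≠ 0 := by
  rintro rfl
  obtain ⟨u, -, -, h⟩ := h
  simp at h

/-- For non-orthogonal `x`, `y` the vector witnessing that `x` is good can be taken orthogonal
to `y`. -/
theorem Good.exists_perp {f : LinearMap.BilinForm K V} (hf : f.IsAlt) {x y : V} (hx : P.sing x)
    (hxy : P.form x y ≠ 0) (h : P.Good f x) :
    ∃ u, P.sing u ∧ P.form x u = 0 ∧ P.form y u = 0 ∧ f x u ≠ 0 := by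
  obtain ⟨u, hu, hxu, hfu⟩ := h
  have hyx := P.form_comm_ne hxy
  refine ⟨u + (-(P.form y u / P.form y x)) • x, P.sing_add_smul _ hu hx (P.form_symm hxu), ?_, ?_,
    ?_⟩
  · simp [hxu, P.form_self hx]
  · rw [map_add, map_smul, smul_eq_mul]; field_simp; ring
  · simpa [hf x] using hfu

/-- Otherwise the functional of `x` would be a multiple of that of `p`, and the corresponding
difference of `x` and a multiple of `p` would be a singular vector in the radical. -/
theorem exists_perp_not_perp {x p : V} (hx : P.sing x) (hp : P.sing p) (hxp : P.form x p = 0)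
    (h : ∀ c : K, x ≠ c • p) : ∃ v, P.form p v = 0 ∧ P.form x v ≠ 0 := by
  by_contra! h'
  obtain ⟨c, hc⟩ := exists_eq_smul_of_ker_le _ _ h'
  refine h (P.twist.symm c) (eq_of_sub_eq_zero (P.eq_zero ?_ fun y => ?_))
  · simpa [sub_eq_add_neg] using P.sing_add_smul (-P.twist.symm c) hx hp hxp
  · rw [sub_eq_add_neg, ← neg_smul, P.form_add_apply, P.form_smul_apply, hc]
    simp

variable [FiniteDimensional K V]

/-- Non-orthogonal good singular vectors have a common neighbour. -/
theorem TS.exists_common_neighbour {U : Submodule K V} (hU : P.TS U)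
    (hr : 3 ≤ Module.finrank K U) {f : LinearMap.BilinForm K V} (hf : f.IsAlt) {x y : V}
    (hx : P.sing x) (hy : P.sing y) (hxy : P.form x y ≠ 0) (hgx : P.Good f x)
    (hgy : P.Good f y) :
    ∃ z, P.sing z ∧ P.form x z = 0 ∧ P.form y z = 0 ∧ f x z ≠ 0 ∧ f y z ≠ 0 := by
  obtain ⟨z, hz, hxz, hyz, hfz⟩ := hgx.exists_perp hf hx hxy
  obtain ⟨w, hw, hyw, hxw, hfw⟩ := hgy.exists_perp hf hy (P.form_comm_ne hxy)
  -- Without a common neighbour, `z` works only for `x` and `w` only for `y`, so a sum of orthogonal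
  -- vectors with these values works for both. If `z` and `w` are not orthogonal, a hyperbolic pair
  -- `u`, `u'` on which `f x` and `f y` vanish corrects them.
  by_contra! hcon
  have hyz0 := hcon z hz hxz hyz hfz
  have hxw0 : f x w = 0 := by
    by_contra h
    exact hfw (hcon w hw hxw hyw h)
  by_cases hzw : P.form z w = 0
  · have := hcon (z + w) (P.sing_add hz hw hzw) (by simp [hxz, hxw]) (by simp [hyz, hyw])
      (by simpa [hxw0])
    rw [map_add, hyz0, zero_add] at this
    exact hfw this
  obtain ⟨u, u', hu, hu', huu, ⟨hxu, hyu, hzu, hwu⟩, hxu', hyu', hzu', hwu'⟩ :=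
    hU.exists_hyperbolic hr hx hy hz hw hxy hzw hxz hxw hyz hyw
  have van : ∀ u, P.sing u → P.form x u = 0 → P.form y u = 0 → P.form z u = 0 → P.form w u = 0 →
      f x u = 0 ∧ f y u = 0 := by
    intro u hu hxu hyu hzu hwu
    have h1 : f x u = 0 := by
      by_contra h
      have h2 := hcon u hu hxu hyu h
      have := hcon (w + u) (P.sing_add hw hu hwu) (by simp [hxw, hxu]) (by simp [hyw, hyu])
        (by simpa [hxw0])
      rw [map_add, h2, add_zero] at this
      exact hfw this
    refine ⟨h1, ?_⟩
    have := hcon (z + u) (P.sing_add hz hu hzu) (by simp [hxz, hxu]) (by simp [hyz, hyu])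
      (by simpa [h1])
    rwa [map_add, hyz0, zero_add] at this
  obtain ⟨hu1, hu2⟩ := van u hu hxu hyu hzu hwu
  obtain ⟨hu3, hu4⟩ := van u' hu' hxu' hyu' hzu' hwu'
  obtain ⟨b, hb⟩ := exists_smul_perp (y := z) (z := w) hzu' hwu huu
  have := hcon (z + u + (w + b • u'))
    (P.sing_add (P.sing_add hz hu hzu) (P.sing_add_smul b hw hu' hwu') hb)
    (by simp [hxz, hxu, hxw, hxu']) (by simp [hyz, hyu, hyw, hyu']) (by simpa [hu1, hxw0, hu3])
  simp [hyz0, hu2, hu4] at this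
  exact hfw this

/-- If `z` is not good, `f z` vanishes on the singular vectors of the perp of `z`, hence on the
whole perp, which is the kernel of `P.form z`. -/
theorem TS.exists_eq_mul_form {U : Submodule K V} (hU : P.TS U) (hr : 3 ≤ Module.finrank K U)
    {f : LinearMap.BilinForm K V} {z : V} (hz : P.sing z) (hz0 : z ≠ 0) (h : ¬ P.Good f z) :
    ∃ c : K, ∀ v, f z v = c * P.form z v := by
  obtain ⟨c, hc⟩ := exists_eq_smul_of_ker_le (P.form z) (f z) fun v hv =>
    hU.eq_zero_of_perp hr hz hz0 (f z) (fun w hw hzw => by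
      by_contra hne
      exact h ⟨w, hw, hzw, hne⟩) hv
  exact ⟨c, fun v => by rw [hc]; rfl⟩

/-- If all points but one of a totally singular line are not good, neither is the last one. -/
theorem TS.not_good_of_line {U : Submodule K V} (hU : P.TS U) (hr : 3 ≤ Module.finrank K U)
    {f : LinearMap.BilinForm K V} {z p : V} (hz : P.sing z) (hp : P.sing p)
    (hzp : P.form z p = 0) (h1 : ∀ c : K, z ≠ c • p) (h2 : ∀ c : K, p ≠ c • z)
    (h : ∀ t : K, ¬ P.Good f (z + t • p)) : ¬ P.Good f p := by
  have hz0 : z ≠ 0 := fun h => h1 0 (by rw [h, zero_smul])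
  have hbad : ∀ t : K, ∃ c : K, ∀ v, f (z + t • p) v = c * P.form (z + t • p) v := fun t =>
    hU.exists_eq_mul_form hr (P.sing_add_smul t hz hp hzp)
      (fun h0 => h1 (-t) (by rw [neg_smul]; exact eq_neg_of_add_eq_zero_left h0)) (h t)
  have hexp : ∀ t v, f (z + t • p) v = f z v + t * f p v := fun t v => by simp
  have hexp' : ∀ t v, P.form (z + t • p) v = P.form z v + P.twist t * P.form p v := fun t v => by
    rw [P.form_add_apply, P.form_smul_apply]
  simp only [hexp, hexp'] at hbad
  obtain ⟨c, hc⟩ := hbad 0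
  obtain ⟨d, hd⟩ := hbad 1
  simp only [map_zero, map_one, zero_mul, one_mul, add_zero] at hc hd
  -- Let `k` be the factor at `z + t • p`. Testing on a vector orthogonal to `p` but not to `z`, and
  -- on one orthogonal to `z` but not to `p`, gives two equations for `k`; eliminating it leaves the
  -- identity of `twist_sep`. Once `d = c`, also `f p` is `c` times the polar form.
  have hdc : d = c := by
    refine P.twist_sep _ _ fun t => ?_
    obtain ⟨k, hk⟩ := hbad t
    obtain ⟨v, hv, hv'⟩ := exists_perp_not_perp hz hp hzp h1
    obtain ⟨w, hw, hw'⟩ := exists_perp_not_perp hp hz (P.form_symm hzp) h2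
    have e1 : k = c + t * (d - c) := by
      refine mul_right_cancel₀ hv' ?_
      have a1 := hk v
      have a2 := hd v
      rw [hc, hv] at a1 a2
      linear_combination t * a2 - a1
    have e2 : k * P.twist t = t * d := by
      refine mul_right_cancel₀ hw' ?_
      have a1 := hk w
      have a2 := hd w
      rw [hc, hw] at a1 a2
      linear_combination t * a2 - a1
    rw [e1] at e2
    linear_combination e2
  rintro ⟨u, -, hpu, hfu⟩
  apply hfu
  have := hd u
  rw [hc, hdc, hpu] at this
  linear_combination this

/-- For orthogonal good singular vectors there is a good singular vector orthogonal to none of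
them. -/
theorem TS.exists_good_not_perp {U : Submodule K V} (hU : P.TS U)
    (hr : 3 ≤ Module.finrank K U) {f : LinearMap.BilinForm K V} {x y : V}
    (hx : P.sing x) (hy : P.sing y) (hxy : P.form x y = 0) (hgx : P.Good f x)
    (hgy : P.Good f y) :
    ∃ z, P.sing z ∧ P.form x z ≠ 0 ∧ P.form y z ≠ 0 ∧ P.Good f z := by
  by_contra! hcon
  obtain ⟨U₁, hU₁, hxU, hr1, -⟩ := hU.exists_mem hx
  obtain ⟨U₂, hU₂, hyU, hr2, hle, -⟩ := hU₁.exists_mem hy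
  have hxU : x ∈ U₂ := hle ⟨hxU, P.form_symm hxy⟩
  obtain ⟨p, hpU, hp⟩ : ∃ p ∈ U₂, p ∉ Submodule.span K ({x, y} : Set V) := by
    by_contra! h
    have h1 := Submodule.finrank_mono (show U₂ ≤ Submodule.span K ({x, y} : Set V) from h)
    have h2 : Module.finrank K (Submodule.span K ({x, y} : Set V)) ≤ 2 := by
      classical
      have := finrank_span_finset_le_card (R := K) ({x, y} : Finset V)
      rw [Finset.coe_insert, Finset.coe_singleton] at this
      exact this.trans Finset.card_le_two
    omega
  have hps := (hU₂ p hpU p hpU).1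
  have hxp : P.form x p = 0 := (hU₂ x hxU p hpU).2
  have hyp : P.form y p = 0 := (hU₂ y hyU p hpU).2
  have hcomb : ∀ a b : K, p ≠ a • x + b • y := fun a b h =>
    hp (h ▸ Submodule.mem_span_pair.2 ⟨a, b, rfl⟩)
  -- Take a singular vector orthogonal to `q` but to neither `x` nor `y`. On its line with `q`, all
  -- points but `q` are orthogonal to neither, hence not good by assumption, so `q` is not good.
  -- Then all points but `x` of the line through `p` and `x` are not good, a contradiction.
  have hbad : ∀ s : K, ¬ P.Good f (p + s • x) := by
    intro s
    set q := p + s • x with hq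
    have hqs : P.sing q := P.sing_add_smul s hps hx (P.form_symm hxp)
    have hqcomb : ∀ a b : K, q ≠ a • x + b • y := fun a b h => hcomb (a - s) b (by
      rw [sub_smul, sub_add_eq_add_sub, ← h, hq, add_sub_cancel_right])
    have hxq : P.form x q = 0 := by simp [hq, hxp, P.form_self hx]
    have hyq : P.form y q = 0 := by simp [hq, hyp, P.form_symm hxy]
    have hne : ∀ (a b c : K), a • x + b • y ≠ 0 → a • x + b • y ≠ c • q := by
      intro a b c h0 h
      have hc : c ≠ 0 := by
        rintro rfl
        exact h0 (by rw [h, zero_smul])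
      refine hqcomb (c⁻¹ * a) (c⁻¹ * b) ?_
      rw [mul_smul, mul_smul, ← smul_add, h, inv_smul_smul₀ hc]
    obtain ⟨v, hqv, hxv⟩ := exists_perp_not_perp hx hqs hxq fun c h =>
      hne 1 0 c (by simpa using hgx.ne_zero) (by simpa using h)
    obtain ⟨w, hqw, hyw⟩ := exists_perp_not_perp hy hqs hyq fun c h =>
      hne 0 1 c (by simpa using hgy.ne_zero) (by simpa using h)
    obtain ⟨u, hqu, hxu, hyu⟩ := exists_ne_zero_and_ne_zero (LinearMap.ker (P.form q))
      (map_add (P.form x)) (map_add (P.form y)) hqv hqw hxv hyw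
    have hqu : P.form q u = 0 := hqu
    obtain ⟨a, ha, hxa⟩ := exists_partner hx hxu
    have hya : P.form y (u + a • x) ≠ 0 := by simpa [P.form_symm hxy]
    have hqa : P.form q (u + a • x) = 0 := by simp [hqu, P.form_symm hxq]
    have haq := P.form_symm hqa
    refine hU.not_good_of_line hr ha hqs haq ?_ ?_ fun t => hcon _ (P.sing_add_smul t ha hqs haq)
      (by rwa [map_add, map_smul, hxq, smul_zero, add_zero])
      (by rwa [map_add, map_smul, hyq, smul_zero, add_zero])
    · intro c h
      rw [h] at hxa
      simp [hxq] at hxa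
    · intro c h
      have h1 := hxq
      rw [h, map_smul, smul_eq_mul, mul_eq_zero] at h1
      refine hqcomb 0 0 ?_
      rw [h, h1.resolve_right hxa]
      simp
  refine hU.not_good_of_line hr hps hx (P.form_symm hxp) (fun c h => hcomb c 0 (by simpa using h))
    (fun c h => ?_) hbad hgx
  by_cases hc : c = 0
  · exact hgx.ne_zero (by rw [h, hc, zero_smul])
  · refine hcomb c⁻¹ 0 ?_
    rw [zero_smul, add_zero]
    rw [h, inv_smul_smul₀ hc]

/-- In rank at least three an alternating form is determined up to a scalar, on orthogonal singular
vectors, by the totally singular lines on which it vanishes. -/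
theorem TS.exists_eq_mul {U : Submodule K V} (hU : P.TS U) (hr : 3 ≤ Module.finrank K U)
    {f g : LinearMap.BilinForm K V} (hf : f.IsAlt) (hg : g.IsAlt)
    (hfg : ∀ x y, P.sing x → P.sing y → P.form x y = 0 → f x y = 0 → g x y = 0) :
    ∃ c : K, ∀ x y, P.sing x → P.sing y → P.form x y = 0 → g x y = c * f x y := by
  have hpt : ∀ x, P.sing x → ∃ c : K, ∀ y, P.sing y → P.form x y = 0 → g x y = c * f x y := by
    intro x hx
    by_cases hx0 : x = 0
    · exact ⟨0, fun y _ _ => by simp [hx0]⟩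
    · exact hU.exists_eq_mul_on_residue hr hx hx0 (f x) (g x) fun y hy => hfg x y hx hy
  choose! c hc using hpt
  have adj : ∀ x y, P.sing x → P.sing y → P.form x y = 0 → f x y ≠ 0 → c x = c y := by
    intro x y hx hy hxy hne
    have h1 := hc x hx y hy hxy
    have h2 := hc y hy x hx (P.form_symm hxy)
    rw [← hf.neg_eq, ← hg.neg_eq] at h2
    refine mul_right_cancel₀ hne ?_
    linear_combination -h1 - h2
  have conn : ∀ x y, P.sing x → P.sing y → P.form x y ≠ 0 → P.Good f x → P.Good f y →
      c x = c y := by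
    intro x y hx hy hxy hgx hgy
    obtain ⟨z, hz, hxz, hyz, h1, h2⟩ := hU.exists_common_neighbour hr hf hx hy hxy hgx hgy
    exact (adj x z hx hz hxz h1).trans (adj y z hy hz hyz h2).symm
  have conn' : ∀ x y, P.sing x → P.sing y → P.Good f x → P.Good f y → c x = c y := by
    intro x y hx hy hgx hgy
    by_cases hxy : P.form x y = 0
    · obtain ⟨z, hz, hxz, hyz, hgz⟩ := hU.exists_good_not_perp hr hx hy hxy hgx hgy
      exact (conn x z hx hz hxz hgx hgz).trans (conn y z hy hz hyz hgy hgz).symm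
    · exact conn x y hx hy hxy hgx hgy
  by_cases h0 : ∃ x, P.sing x ∧ P.Good f x
  · obtain ⟨x₀, hx₀, hg₀⟩ := h0
    refine ⟨c x₀, fun x y hx hy hxy => ?_⟩
    by_cases hxy' : f x y = 0
    · rw [hxy', hfg x y hx hy hxy hxy', mul_zero]
    · rw [conn' x₀ x hx₀ hx hg₀ ⟨y, hy, hxy, hxy'⟩, hc x hx y hy hxy]
  · push Not at h0
    refine ⟨0, fun x y hx hy hxy => ?_⟩
    have : f x y = 0 := by
      by_contra h
      exact h0 x hx ⟨y, hy, hxy, h⟩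
    rw [hfg x y hx hy hxy this, zero_mul]

end PolarForm

/-! ### The symplectic case -/

section Symplectic

variable {K V : Type*} [Field K] [AddCommGroup V] [Module K V]

/-- The analogue of `PolarForm.TS.exists_eq_mul` for an alternating form. -/
theorem exists_eq_mul_of_isAlt {B : LinearMap.BilinForm K V} (hB : B.IsAlt)
    (hB' : B.Nondegenerate) {f g : LinearMap.BilinForm K V} (hf : f.IsAlt) (hg : g.IsAlt)
    (hfg : ∀ x y, B x y = 0 → f x y = 0 → g x y = 0) :
    ∃ c : K, ∀ x y, B x y = 0 → g x y = c * f x y := by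
  have symm : ∀ {x y}, B x y = 0 → B y x = 0 := fun {x y} h => hB.isRefl x y h
  choose c hc using fun x => exists_eq_mul_of_forall_mem (LinearMap.ker (B x)) (f x) (g x)
    fun y hy => hfg x y hy
  have adj : ∀ x y, B x y = 0 → f x y ≠ 0 → c x = c y := by
    intro x y hxy hne
    have h1 := hc x y hxy
    have h2 := hc y x (symm hxy)
    rw [← hf.neg_eq, ← hg.neg_eq] at h2
    refine mul_right_cancel₀ hne ?_
    linear_combination -h1 - h2
  have perp : ∀ x y, B x y ≠ 0 → (∃ u, B x u = 0 ∧ f x u ≠ 0) →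
      ∃ u ∈ LinearMap.ker (B x) ⊓ LinearMap.ker (B y), f x u ≠ 0 := by
    rintro x y hxy ⟨u, hxu, hfu⟩
    have hyx : B y x ≠ 0 := fun h => hxy (symm h)
    refine ⟨u + (-(B y u / B y x)) • x, ⟨?_, ?_⟩, ?_⟩
    · simp [hxu, hB x]
    · simp [hyx]
    · simpa [hf x] using hfu
  have conn : ∀ x y, B x y ≠ 0 → (∃ u, B x u = 0 ∧ f x u ≠ 0) → (∃ u, B y u = 0 ∧ f y u ≠ 0) →
      c x = c y := by
    intro x y hxy hx hy
    obtain ⟨v, hv, hfv⟩ := perp x y hxy hx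
    obtain ⟨w, hw, hfw⟩ := perp y x (fun h => hxy (symm h)) hy
    rw [inf_comm] at hw
    obtain ⟨z, ⟨hxz, hyz⟩, h1, h2⟩ := exists_ne_zero_and_ne_zero _ (map_add (f x)) (map_add (f y))
      hv hw hfv hfw
    exact (adj x z hxz h1).trans (adj y z hyz h2).symm
  have conn' : ∀ x y, (∃ u, B x u = 0 ∧ f x u ≠ 0) → (∃ u, B y u = 0 ∧ f y u ≠ 0) →
      c x = c y := by
    intro x y hx hy
    by_cases hxy : B x y = 0
    swap
    · exact conn x y hxy hx hy
    have ne : ∀ x, (∃ u, B x u = 0 ∧ f x u ≠ 0) → ∃ v, B x v ≠ 0 := by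
      rintro x ⟨u, -, hu⟩
      by_contra! h
      rw [hB'.1 x h] at hu
      simp at hu
    obtain ⟨v, hv⟩ := ne x hx
    obtain ⟨w, hw⟩ := ne y hy
    obtain ⟨z, -, hxz, hyz⟩ := exists_ne_zero_and_ne_zero ⊤ (map_add (B x)) (map_add (B y))
      trivial trivial hv hw
    -- Adding multiples of `x` to `z` changes neither `B x z` nor `B y z`. If neither `z` nor `z +
    -- x` were good, evaluation at `x` would give both the same factor, making `f x` a multiple of
    -- `B x`, although `x` is good.
    suffices ∃ s : K, ∃ u, B (z + s • x) u = 0 ∧ f (z + s • x) u ≠ 0 by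
      obtain ⟨s, hs⟩ := this
      exact (conn x (z + s • x) (by simpa [hB x] using hxz) hx hs).trans
        (conn y (z + s • x) (by simpa [symm hxy] using hyz) hy hs).symm
    by_contra! hcon
    have hbad : ∀ s : K, ∃ d : K, ∀ v, f z v + s * f x v = d * (B z v + s * B x v) := by
      intro s
      obtain ⟨d, hd⟩ := exists_eq_smul_of_ker_le (B (z + s • x)) (f (z + s • x)) (hcon s)
      exact ⟨d, fun v => by simpa [mul_add] using congrArg (fun k => k v) hd⟩
    obtain ⟨d₀, h0⟩ := hbad 0
    obtain ⟨d₁, h1⟩ := hbad 1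
    simp only [zero_mul, add_zero, one_mul] at h0 h1
    have hzx : B z x ≠ 0 := fun h => hxz (symm h)
    have a1 := h1 x
    rw [h0, hB x, hf x] at a1
    have e1 : d₀ = d₁ := mul_right_cancel₀ hzx (by linear_combination a1)
    obtain ⟨u, hxu, hfu⟩ := hx
    have a3 := h1 u
    rw [h0, hxu, e1] at a3
    exact hfu (by linear_combination a3)
  by_cases h0 : ∃ x, ∃ u, B x u = 0 ∧ f x u ≠ 0
  · obtain ⟨x₀, hx₀⟩ := h0
    refine ⟨c x₀, fun x y hxy => ?_⟩
    by_cases hxy' : f x y = 0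
    · rw [hxy', hfg x y hxy hxy', mul_zero]
    · rw [conn' x₀ x hx₀ ⟨y, hxy, hxy'⟩, hc x y hxy]
  · push Not at h0
    exact ⟨0, fun x y hxy => by rw [hfg x y hxy (h0 x y hxy), zero_mul]⟩

end Symplectic

/-! ### Hyperplane complements in the point-hyperplane geometry -/

section Flags

variable {K V : Type*} [Field K] [AddCommGroup V] [Module K V]

theorem exists_dual_eq {ι : Type*} {v : ι → V} (hv : LinearIndependent K v) (c : ι → K) :
    ∃ f : Module.Dual K V, ∀ i, f (v i) = c i := by
  obtain ⟨f, hf⟩ := LinearMap.exists_extend ((Module.Basis.span hv).constr K c)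
  refine ⟨f, fun i => ?_⟩
  have h1 := congrArg (fun g => g (Module.Basis.span hv i)) hf
  rwa [Module.Basis.constr_basis, LinearMap.comp_apply, Submodule.subtype_apply,
    Module.Basis.span_apply] at h1

theorem exists_dual_ne_zero_of_notMem_span_pair {x y z : V}
    (h : z ∉ Submodule.span K ({x, y} : Set V)) :
    ∃ f : Module.Dual K V, f x = 0 ∧ f y = 0 ∧ f z ≠ 0 := by
  obtain ⟨f, hf, hle⟩ := Submodule.exists_le_ker_of_notMem h
  exact ⟨f, hle (Submodule.subset_span (by simp)), hle (Submodule.subset_span (by simp)), hf⟩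

theorem exists_dual_ne_zero_of_notMem_span_singleton {x z : V} (h : z ∉ K ∙ x) :
    ∃ f : Module.Dual K V, f x = 0 ∧ f z ≠ 0 := by
  obtain ⟨f, hf, hle⟩ := Submodule.exists_le_ker_of_notMem h
  exact ⟨f, hle (Submodule.mem_span_singleton_self x), hf⟩

theorem exists_mem_ker_ne_zero {ξ η ζ : Module.Dual K V} (h : ∀ s t : K, ζ ≠ s • ξ + t • η) :
    ∃ v, ξ v = 0 ∧ η v = 0 ∧ ζ v ≠ 0 := by
  by_contra! hcon
  have := mem_span_of_iInf_ker_le_ker (L := ![ξ, η]) (K := ζ) fun v hv => by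
    rw [Submodule.mem_iInf] at hv
    exact hcon v (hv 0) (hv 1)
  rw [Matrix.range_cons, Matrix.range_cons, Matrix.range_empty, Set.union_empty] at this
  obtain ⟨s, t, hst⟩ := Submodule.mem_span_pair.1 this
  exact h s t hst.symm

/-- A flag `(x, ξ)` at which the hyperplane of the point-hyperplane geometry described by `b` is
avoided. -/
def Avoids (b : V → V) (x : V) (ξ : Module.Dual K V) : Prop :=
  x ≠ 0 ∧ ξ x = 0 ∧ ξ (b x) ≠ 0

/-- A hyperplane of the point-hyperplane geometry, described by its traces on the singular
subspaces: `(x, ξ)` belongs to it if `ξ (b x) = 0`, or equivalently `a ξ x = 0`. The function `c`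
is constant on each singular subspace, off the hyperplane. -/
structure FlagLabelling (a : Module.Dual K V → Module.Dual K V) (b : V → V) {α : Type*}
    (c : V → Module.Dual K V → α) : Prop where
  iff : ∀ {x ξ}, x ≠ 0 → ξ ≠ 0 → ξ x = 0 → (a ξ x = 0 ↔ ξ (b x) = 0)
  eq_point : ∀ {x ξ η}, Avoids b x ξ → Avoids b x η → c x ξ = c x η
  eq_hyperplane : ∀ {x y ξ}, Avoids b x ξ → Avoids b y ξ → c x ξ = c y ξ

/-- Off the hyperplane, the flags on `x` and the flags on `y` have the same label. -/
def SameLabel (b : V → V) {α : Type*} (c : V → Module.Dual K V → α) (x y : V) : Prop :=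
  ∀ ξ η, Avoids b x ξ → Avoids b y η → c x ξ = c y η

variable {a : Module.Dual K V → Module.Dual K V} {b : V → V} {α : Type*}
  {c : V → Module.Dual K V → α}

theorem SameLabel.symm {x y : V} (h : SameLabel b c x y) : SameLabel b c y x :=
  fun ξ η hξ hη => (h η ξ hη hξ).symm

theorem SameLabel.trans {x y z : V} {ζ : Module.Dual K V} (h : SameLabel b c x y)
    (h' : SameLabel b c y z) (hy : Avoids b y ζ) : SameLabel b c x z :=
  fun ξ η hξ hη => (h ξ ζ hξ hy).trans (h' ζ η hy hη)

namespace FlagLabelling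

theorem avoids_iff (H : FlagLabelling a b c) {x : V} {ξ : Module.Dual K V} (hx : x ≠ 0)
    (hξ : ξ ≠ 0) (h : ξ x = 0) : Avoids b x ξ ↔ a ξ x ≠ 0 :=
  ⟨fun h' => (H.iff hx hξ h).not.2 h'.2.2, fun h' => ⟨hx, h, (H.iff hx hξ h).not.1 h'⟩⟩

theorem sameLabel (H : FlagLabelling a b c) {x y : V} {ζ : Module.Dual K V} (hx : Avoids b x ζ)
    (hy : Avoids b y ζ) : SameLabel b c x y := fun _ _ hξ hη =>
  (H.eq_point hξ hx).trans ((H.eq_hyperplane hx hy).trans (H.eq_point hy hη))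

/-- A functional vanishing at `x` and `y` but at neither `b x` nor `b y` is a hyperplane linking the
two points. -/
theorem sameLabel_of_notMem (H : FlagLabelling a b c) {x y : V} (hx : x ≠ 0) (hy : y ≠ 0)
    (hbx : b x ∉ Submodule.span K ({x, y} : Set V))
    (hby : b y ∉ Submodule.span K ({x, y} : Set V)) : SameLabel b c x y := by
  obtain ⟨f, hf, hf', hfb⟩ := exists_dual_ne_zero_of_notMem_span_pair hbx
  obtain ⟨g, hg, hg', hgb⟩ := exists_dual_ne_zero_of_notMem_span_pair hby
  obtain ⟨ζ, ⟨hζ, hζ'⟩, h1, h2⟩ := exists_ne_zero_and_ne_zero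
    (LinearMap.ker (Module.Dual.eval K V x) ⊓ LinearMap.ker (Module.Dual.eval K V y))
    (map_add (Module.Dual.eval K V (b x))) (map_add (Module.Dual.eval K V (b y)))
    (v := f) (w := g) ⟨hf, hf'⟩ ⟨hg, hg'⟩ hfb hgb
  exact H.sameLabel (ζ := ζ) ⟨hx, hζ, h1⟩ ⟨hy, hζ', h2⟩

/-- Supplies the configuration for the count in `sameLabel_of_mem`. Over the field of two elements,
values at `q`, `p`, `p'` alone allow only two choices of `η`; a third scalar or a fourth coordinate
`r` gives the third. -/
theorem exists_functionals {p p' q : V} (hd : (∃ t : K, t ≠ 0 ∧ t ≠ 1) ∨ 4 ≤ Module.finrank K V)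
    (hli : LinearIndependent K ![q, p, p']) :
    ∃ (μ₁ μ₂ : Module.Dual K V) (η : Fin 3 → Module.Dual K V),
      (μ₁ p = 0 ∧ μ₁ p' ≠ 0 ∧ μ₁ q ≠ 0) ∧ (μ₂ p = 0 ∧ μ₂ p' ≠ 0 ∧ μ₂ q ≠ 0) ∧
      (∀ i, η i q = 0 ∧ η i p ≠ 0) ∧ (∀ r : K, μ₁ ≠ r • μ₂) ∧
      ∀ i j, i < j → ∀ r : K, η i ≠ r • η j := by
  have sep : ∀ (f g : Module.Dual K V) (x y : V), f x = 1 → g x = 1 → f y ≠ g y →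
      ∀ r : K, f ≠ r • g := by
    rintro f g x y hf hg hne r rfl
    simp only [LinearMap.smul_apply, hg, smul_eq_mul, mul_one] at hf
    simp [hf] at hne
  have fin3 : ∀ η₁ η₂ η₃ : Module.Dual K V, (∀ r : K, η₁ ≠ r • η₂) → (∀ r : K, η₁ ≠ r • η₃) →
      (∀ r : K, η₂ ≠ r • η₃) → ∀ i j, i < j → ∀ r : K, ![η₁, η₂, η₃] i ≠ r • ![η₁, η₂, η₃] j := by
    intro η₁ η₂ η₃ h1 h2 h3 i j hij
    fin_cases i <;> fin_cases j <;> first | assumption | exact absurd hij (by decide)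
  obtain ⟨t, ht0, ht1⟩ | hd := hd
  · have ex : ∀ x y z : K, ∃ f : Module.Dual K V, f q = x ∧ f p = y ∧ f p' = z := fun x y z => by
      obtain ⟨f, hf⟩ := exists_dual_eq hli ![x, y, z]
      exact ⟨f, hf 0, hf 1, hf 2⟩
    obtain ⟨μ₁, a1, a2, a3⟩ := ex 1 0 1
    obtain ⟨μ₂, b1, b2, b3⟩ := ex t 0 1
    obtain ⟨η₁, c1, c2, c3⟩ := ex 0 1 0
    obtain ⟨η₂, d1, d2, d3⟩ := ex 0 1 1
    obtain ⟨η₃, e1, e2, e3⟩ := ex 0 1 t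
    refine ⟨μ₁, μ₂, ![η₁, η₂, η₃], by simp [*], by simp [*],
      by intro i; fin_cases i <;> simp [*],
      sep _ _ p' q a3 b3 (by rw [a1, b1]; exact ht1.symm),
      fin3 _ _ _ (sep _ _ p p' c2 d2 (by simp [*]))
      (sep _ _ p p' c2 e2 (by rw [c3, e3]; exact ht0.symm))
      (sep _ _ p p' d2 e2 (by rw [d3, e3]; exact ht1.symm))⟩
  · obtain ⟨r, hr⟩ : ∃ r, r ∉ Submodule.span K (Set.range ![q, p, p']) := by
      by_contra! h
      have h1 := finrank_range_le_card (R := K) ![q, p, p']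
      rw [Set.finrank, Submodule.eq_top_iff'.2 h, finrank_top, Fintype.card_fin] at h1
      omega
    have ex : ∀ w x y z : K, ∃ f : Module.Dual K V, f r = w ∧ f q = x ∧ f p = y ∧ f p' = z :=
      fun w x y z => by
        obtain ⟨f, hf⟩ := exists_dual_eq (linearIndependent_finCons.2 ⟨hli, hr⟩) ![w, x, y, z]
        exact ⟨f, hf 0, hf 1, hf 2, hf 3⟩
    obtain ⟨μ₁, a0, a1, a2, a3⟩ := ex 0 1 0 1
    obtain ⟨μ₂, b0, b1, b2, b3⟩ := ex 1 1 0 1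
    obtain ⟨η₁, c0, c1, c2, c3⟩ := ex 0 0 1 0
    obtain ⟨η₂, d0, d1, d2, d3⟩ := ex 0 0 1 1
    obtain ⟨η₃, e0, e1, e2, e3⟩ := ex 1 0 1 0
    exact ⟨μ₁, μ₂, ![η₁, η₂, η₃], by simp [*], by simp [*],
      by intro i; fin_cases i <;> simp [*],
      sep _ _ p' r a3 b3 (by simp [*]), fin3 _ _ _ (sep _ _ p p' c2 d2 (by simp [*]))
      (sep _ _ p r c2 e2 (by simp [*])) (sep _ _ p p' d2 e2 (by simp [*]))⟩

/-- Pigeonhole: every index satisfies `B₁` or `B₂`, so one of them holds for two of the three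
indices. -/
theorem not_forall_of_three {A₁ A₂ B₁ B₂ : Fin 3 → Prop} (h₁ : ∀ i, A₁ i ∨ B₁ i)
    (h₂ : ∀ i, A₂ i ∨ B₂ i) (hA : ∀ i, ¬ (A₁ i ∧ A₂ i)) (hB₁ : ∀ i j, i < j → ¬ (B₁ i ∧ B₁ j))
    (hB₂ : ∀ i j, i < j → ¬ (B₂ i ∧ B₂ j)) : False := by
  have h : ∀ i, B₁ i ∨ B₂ i := fun i => by
    rcases h₁ i with h | h
    · exact (h₂ i).elim (fun h' => (hA i ⟨h, h'⟩).elim) Or.inr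
    · exact Or.inl h
  have a := hB₁ 0 1 (by decide)
  have b := hB₁ 0 2 (by decide)
  have c := hB₁ 1 2 (by decide)
  have d := hB₂ 0 1 (by decide)
  have e := hB₂ 0 2 (by decide)
  have f := hB₂ 1 2 (by decide)
  rcases h 0 with h0 | h0 <;> rcases h 1 with h1 | h1 <;> rcases h 2 with h2 | h2 <;> tauto

/-- If the labels differ, `b w` lies in the span of `p` and `w` for every `w` outside the span of
`p` and `p'` that carries an avoiding flag and the label of `p'`. This rigidity forces `a η` or `a
μ` into the pencil of `η` and `μ`, for all `η` through `q` off `p` and all `μ` through `p` off `p'`.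
Each `a μ` with `μ q ≠ 0` allows only one such `η` up to scalars, and each `a η` only one such `μ`.
Three `η` and two `μ` are too many. -/
theorem sameLabel_of_mem (H : FlagLabelling a b c)
    (hd : 3 ≤ Module.finrank K V) (hd' : (∃ t : K, t ≠ 0 ∧ t ≠ 1) ∨ 4 ≤ Module.finrank K V)
    {p p' : V} (hp : p ≠ 0) (hp' : p' ≠ 0) (hbp : b p ∉ K ∙ p) (hbp' : b p' ∉ K ∙ p')
    (hmem : b p ∈ Submodule.span K ({p, p'} : Set V)) : SameLabel b c p p' := by
  by_contra hn
  obtain ⟨α, β, hαβ⟩ := Submodule.mem_span_pair.1 hmem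
  have hβ : β ≠ 0 := by
    rintro rfl
    exact hbp (Submodule.mem_span_singleton.2 ⟨α, by simpa using hαβ⟩)
  have hpp' : p ∉ K ∙ p' := by
    intro h
    obtain ⟨r, rfl⟩ := Submodule.mem_span_singleton.1 h
    have hr : r ≠ 0 := by
      rintro rfl
      simp at hp
    refine hbp (Submodule.mem_span_singleton.2 ⟨α + β * r⁻¹, ?_⟩)
    rw [← hαβ, add_smul, smul_smul (β * r⁻¹), mul_assoc, inv_mul_cancel₀ hr, mul_one]
  obtain ⟨f, hf, hfb⟩ := exists_dual_ne_zero_of_notMem_span_singleton hbp'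
  obtain ⟨g, hg, hgp⟩ := exists_dual_ne_zero_of_notMem_span_singleton hpp'
  obtain ⟨ξ, hξ, hξb, hξp⟩ := exists_ne_zero_and_ne_zero
    (LinearMap.ker (Module.Dual.eval K V p')) (map_add (Module.Dual.eval K V (b p')))
    (map_add (Module.Dual.eval K V p)) (v := f) (w := g) hf hg hfb hgp
  simp only [LinearMap.mem_ker, Module.Dual.eval_apply] at hξ hξb hξp
  have hξ0 : ξ ≠ 0 := by rintro rfl; simp at hξp
  have hav' : Avoids b p' ξ := ⟨hp', hξ, hξb⟩
  have haξ := (H.avoids_iff hp' hξ0 hξ).1 hav'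
  -- Project a vector outside the span to the kernel of `ξ` along `p`; if `a ξ` vanishes there, add
  -- `p'`, where it does not.
  obtain ⟨q, hq, hξq, haq⟩ : ∃ q, q ∉ Submodule.span K ({p, p'} : Set V) ∧ ξ q = 0 ∧
      a ξ q ≠ 0 := by
    obtain ⟨s, hs⟩ : ∃ s, s ∉ Submodule.span K ({p, p'} : Set V) := by
      by_contra! h
      have h1 := finrank_range_le_card (R := K) ![p, p']
      rw [Set.finrank, Matrix.range_cons, Matrix.range_cons, Matrix.range_empty, Set.union_empty,
        Set.singleton_union, Submodule.eq_top_iff'.2 h, finrank_top, Fintype.card_fin] at h1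
      omega
    have hp1 : p ∈ Submodule.span K ({p, p'} : Set V) := Submodule.subset_span (by simp)
    have hp2 : p' ∈ Submodule.span K ({p, p'} : Set V) := Submodule.subset_span (by simp)
    set s' := s + (-(ξ s / ξ p)) • p with hs'
    have h1 : s' ∉ Submodule.span K ({p, p'} : Set V) := fun h =>
      hs ((Submodule.add_mem_iff_left _ (Submodule.smul_mem _ _ hp1)).1 h)
    have h2 : ξ s' = 0 := by simp [hs', hξp]
    by_cases h3 : a ξ s' = 0
    · exact ⟨s' + p', fun h => h1 ((Submodule.add_mem_iff_left _ hp2).1 h), by simp [h2, hξ],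
        by simpa [h3]⟩
    · exact ⟨s', h1, h2, h3⟩
  have hq0 : q ≠ 0 := by rintro rfl; simp at haq
  have havq : Avoids b q ξ := (H.avoids_iff hq0 hξ0 hξq).2 haq
  have hqp' : SameLabel b c q p' := H.sameLabel havq hav'
  have mem_span_of_same : ∀ (w : V) (ζ : Module.Dual K V), Avoids b w ζ → SameLabel b c w p' →
      w ∉ Submodule.span K ({p, p'} : Set V) → b w ∈ Submodule.span K ({p, w} : Set V) := by
    intro w ζ hζ hw hw'
    by_contra hcon
    refine hn ((H.sameLabel_of_notMem hp hζ.1 ?_ hcon).trans hw hζ)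
    intro h
    obtain ⟨s, t, hst⟩ := Submodule.mem_span_pair.1 h
    have ht : t ≠ 0 := by
      rintro rfl
      exact hbp (Submodule.mem_span_singleton.2 ⟨s, by simpa using hst⟩)
    refine hw' (Submodule.mem_span_pair.2 ⟨t⁻¹ * (α - s), t⁻¹ * β, ?_⟩)
    rw [mul_smul, mul_smul, ← smul_add, sub_smul, sub_add_eq_add_sub, hαβ, ← hst,
      add_sub_cancel_left, inv_smul_smul₀ ht]
  obtain ⟨γ, δ, hγδ⟩ := Submodule.mem_span_pair.1 (mem_span_of_same q ξ havq hqp' hq)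
  have hγ : γ ≠ 0 := by
    rintro rfl
    refine havq.2.2 ?_
    rw [← hγδ]
    simp [hξq]
  have avq : ∀ η : Module.Dual K V, η q = 0 → η p ≠ 0 → Avoids b q η := fun η h1 h2 =>
    ⟨hq0, h1, by rw [← hγδ]; simp [h1, h2, hγ]⟩
  have avp : ∀ μ : Module.Dual K V, μ p = 0 → μ p' ≠ 0 → Avoids b p μ := fun μ h1 h2 =>
    ⟨hp, h1, by rw [← hαβ]; simp [h1, h2, hβ]⟩
  have not_both : ∀ η μ : Module.Dual K V, η q = 0 → η p ≠ 0 → μ p = 0 → μ p' ≠ 0 →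
      ∀ w, η w = 0 → μ w = 0 → a η w ≠ 0 → a μ w = 0 := by
    -- If `a η w ≠ 0`, then `w` shares with `q` the hyperplane `η`, so `b w` lies in the span of `p`
    -- and `w`, where `μ` vanishes.
    intro η μ hηq hηp hμp hμp' w hηw hμw haw
    have hη0 : η ≠ 0 := by rintro rfl; simp at hηp
    have hμ0 : μ ≠ 0 := by rintro rfl; simp at hμp'
    have hw0 : w ≠ 0 := by rintro rfl; simp at haw
    have hav : Avoids b w η := (H.avoids_iff hw0 hη0 hηw).2 haw
    have hw : b w ∈ Submodule.span K ({p, w} : Set V) := by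
      refine mem_span_of_same w η hav ((H.sameLabel hav (avq η hηq hηp)).trans hqp' havq)
        fun h => hw0 ?_
      obtain ⟨s, t, rfl⟩ := Submodule.mem_span_pair.1 h
      have ht : t = 0 := by simpa [hμp, hμp'] using hμw
      have hs : s = 0 := by simpa [ht, hηp] using hηw
      simp [hs, ht]
    obtain ⟨s, t, hst⟩ := Submodule.mem_span_pair.1 hw
    rw [H.iff hw0 hμ0 hμw, ← hst]
    simp [hμp, hμw]
  have mem_pencil : ∀ η μ : Module.Dual K V, η q = 0 ∧ η p ≠ 0 → μ p = 0 ∧ μ p' ≠ 0 ∧ μ q ≠ 0 →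
      (∃ s t : K, a η = s • η + t • μ) ∨ (∃ s t : K, a μ = s • η + t • μ) := by
    rintro η μ ⟨hηq, hηp⟩ ⟨hμp, hμp', -⟩
    by_contra! hcon
    obtain ⟨v, hv1, hv2, hv3⟩ := exists_mem_ker_ne_zero hcon.1
    obtain ⟨w, hw1, hw2, hw3⟩ := exists_mem_ker_ne_zero hcon.2
    obtain ⟨u, ⟨hu1, hu2⟩, hu3, hu4⟩ := exists_ne_zero_and_ne_zero
      (LinearMap.ker η ⊓ LinearMap.ker μ) (map_add (a η)) (map_add (a μ)) (v := v) (w := w)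
      ⟨hv1, hv2⟩ ⟨hw1, hw2⟩ hv3 hw3
    exact hu4 (not_both η μ hηq hηp hμp hμp' u hu1 hu2 hu3)
  have unique_hyperplane : ∀ η η' μ : Module.Dual K V, η q = 0 ∧ η p ≠ 0 → η' q = 0 ∧ η' p ≠ 0 →
      μ p = 0 ∧ μ p' ≠ 0 ∧ μ q ≠ 0 → (∀ r : K, η ≠ r • η') →
      ¬ ((∃ s t : K, a μ = s • η + t • μ) ∧ ∃ s t : K, a μ = s • η' + t • μ) := by
    rintro η η' μ ⟨hηq, -⟩ ⟨hη'q, -⟩ ⟨hμp, hμp', hμq⟩ hne ⟨⟨s, t, h1⟩, s', t', h2⟩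
    have hμ0 : μ ≠ 0 := by rintro rfl; simp at hμp'
    have hap := (H.avoids_iff hp hμ0 hμp).1 (avp μ hμp hμp')
    have hs : s ≠ 0 := by
      rintro rfl
      rw [h1] at hap
      simp [hμp] at hap
    have htt : t = t' := by
      have e1 := congrArg (fun k => k q) h1
      have e2 := congrArg (fun k => k q) h2
      simp only [LinearMap.add_apply, LinearMap.smul_apply, hηq, hη'q, smul_eq_mul, mul_zero,
        zero_add] at e1 e2
      exact mul_right_cancel₀ hμq (e1.symm.trans e2)
    rw [h2, ← htt, add_left_inj] at h1
    exact hne (s⁻¹ * s') (by rw [mul_smul, h1, inv_smul_smul₀ hs])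
  have unique_dual : ∀ η μ μ' : Module.Dual K V, η q = 0 ∧ η p ≠ 0 → μ p = 0 ∧ μ p' ≠ 0 ∧ μ q ≠ 0 →
      μ' p = 0 ∧ μ' p' ≠ 0 ∧ μ' q ≠ 0 → (∀ r : K, μ ≠ r • μ') →
      ¬ ((∃ s t : K, a η = s • η + t • μ) ∧ ∃ s t : K, a η = s • η + t • μ') := by
    rintro η μ μ' ⟨hηq, hηp⟩ ⟨hμp, -, hμq⟩ ⟨hμ'p, -, -⟩ hne ⟨⟨s, t, h1⟩, s', t', h2⟩
    have hη0 : η ≠ 0 := by rintro rfl; simp at hηp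
    have haq := (H.avoids_iff hq0 hη0 hηq).1 (avq η hηq hηp)
    have ht : t ≠ 0 := by
      rintro rfl
      rw [h1] at haq
      simp [hηq] at haq
    have hss : s = s' := by
      have e1 := congrArg (fun k => k p) h1
      have e2 := congrArg (fun k => k p) h2
      simp only [LinearMap.add_apply, LinearMap.smul_apply, hμp, hμ'p, smul_eq_mul, mul_zero,
        add_zero] at e1 e2
      exact mul_right_cancel₀ hηp (e1.symm.trans e2)
    rw [h2, ← hss, add_right_inj] at h1
    exact hne (t⁻¹ * t') (by rw [mul_smul, h1, inv_smul_smul₀ ht])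
  have hli : LinearIndependent K ![q, p, p'] := by
    refine linearIndependent_finCons.2 ⟨linearIndependent_finCons.2
      ⟨linearIndependent_finCons.2 ⟨linearIndependent_empty_type, by simpa using hp'⟩, ?_⟩, ?_⟩
    · simpa using hpp'
    · simpa [Matrix.range_cons, Set.pair_comm] using hq
  obtain ⟨μ₁, μ₂, η, h1, h2, hη, hμ, hne⟩ := exists_functionals hd' hli
  exact not_forall_of_three (fun i => mem_pencil (η i) μ₁ (hη i) h1)
    (fun i => mem_pencil (η i) μ₂ (hη i) h2)
    (fun i => unique_dual (η i) _ _ (hη i) h1 h2 hμ)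
    (fun i j hij => unique_hyperplane _ _ μ₁ (hη i) (hη j) h1 (hne i j hij))
    (fun i j hij => unique_hyperplane _ _ μ₂ (hη i) (hη j) h2 (hne i j hij))

/-- The complement of a hyperplane of the point-hyperplane geometry is connected. -/
theorem eq_of_avoids (H : FlagLabelling a b c)
    (hd : 3 ≤ Module.finrank K V) (hd' : (∃ t : K, t ≠ 0 ∧ t ≠ 1) ∨ 4 ≤ Module.finrank K V)
    {x y : V} {ξ η : Module.Dual K V} (hx : Avoids b x ξ) (hy : Avoids b y η) :
    c x ξ = c y η := by
  have good : ∀ {x : V} {ξ : Module.Dual K V}, Avoids b x ξ → b x ∉ K ∙ x := by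
    intro x ξ hx h
    obtain ⟨r, hr⟩ := Submodule.mem_span_singleton.1 h
    refine hx.2.2 ?_
    rw [← hr, map_smul, hx.2.1, smul_zero]
  suffices SameLabel b c x y from this ξ η hx hy
  by_cases h1 : b x ∈ Submodule.span K ({x, y} : Set V)
  · exact H.sameLabel_of_mem hd hd' hx.1 hy.1 (good hx) (good hy) h1
  by_cases h2 : b y ∈ Submodule.span K ({x, y} : Set V)
  · rw [Set.pair_comm] at h2
    exact (H.sameLabel_of_mem hd hd' hy.1 hx.1 (good hy) (good hx) h2).symm
  exact H.sameLabel_of_notMem hx.1 hy.1 h1 h2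

end FlagLabelling

end Flags

/-! ### Hyperplanes of a projective space as kernels -/

section LinearAlgebra

variable {K V : Type*} [Field K] [AddCommGroup V] [Module K V]

theorem exists_eq_smul_of_not_linearIndependent {x y : V} (hx : x ≠ 0)
    (h : ¬ LinearIndependent K ![x, y]) : ∃ r : K, y = r • x := by
  rw [LinearIndependent.pair_iff' hx] at h
  push Not at h
  exact h.imp fun _ h => h.symm

/-- A set that meets every line of `H` in one point or contains it is the intersection of `H` with
the kernel of a functional. -/
theorem exists_dual_iff (H : Submodule K V) (Z : V → Prop) (h0 : Z 0)
    (hsmul : ∀ x ∈ H, ∀ r : K, Z x → Z (r • x))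
    (hline : ∀ x ∈ H, ∀ y ∈ H, LinearIndependent K ![x, y] → Z x → Z y → Z (x + y))
    (hmeet : ∀ x ∈ H, ∀ y ∈ H, LinearIndependent K ![x, y] →
      ∃ s t : K, s • x + t • y ≠ 0 ∧ Z (s • x + t • y)) :
    ∃ a : Module.Dual K V, ∀ x ∈ H, Z x ↔ a x = 0 := by
  let S : Submodule K V :=
    { carrier := {x | x ∈ H ∧ Z x}
      zero_mem' := ⟨H.zero_mem, h0⟩
      smul_mem' := fun r x hx => ⟨H.smul_mem r hx.1, hsmul x hx.1 r hx.2⟩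
      add_mem' := by
        rintro x y ⟨hx, hZx⟩ ⟨hy, hZy⟩
        refine ⟨H.add_mem hx hy, ?_⟩
        by_cases hx0 : x = 0
        · rwa [hx0, zero_add]
        by_cases hli : LinearIndependent K ![x, y]
        · exact hline x hx y hy hli hZx hZy
        · obtain ⟨r, rfl⟩ := exists_eq_smul_of_not_linearIndependent hx0 hli
          have := hsmul x hx (1 + r) hZx
          rwa [add_smul, one_smul] at this }
  by_cases hS : ∃ x₀ ∈ H, ¬ Z x₀
  · obtain ⟨x₀, hx₀, hZ₀⟩ := hS
    obtain ⟨a, ha, hle⟩ := Submodule.exists_le_ker_of_notMem (p := S) fun h => hZ₀ h.2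
    refine ⟨a, fun x hx => ⟨fun hZ => hle (show x ∈ S from ⟨hx, hZ⟩), fun hax => ?_⟩⟩
    have hx₀0 : x₀ ≠ 0 := by rintro rfl; exact hZ₀ h0
    by_cases hli : LinearIndependent K ![x₀, x]
    · obtain ⟨s, t, hne, hst⟩ := hmeet x₀ hx₀ x hx hli
      have h1 : a (s • x₀ + t • x) = 0 :=
        hle (show s • x₀ + t • x ∈ S from ⟨H.add_mem (H.smul_mem _ hx₀) (H.smul_mem _ hx), hst⟩)
      have hs : s = 0 := by simpa [hax, ha] using h1
      rw [hs, zero_smul, zero_add] at hst hne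
      have ht : t ≠ 0 := by
        rintro rfl
        simp at hne
      have := hsmul _ (H.smul_mem t hx) t⁻¹ hst
      rwa [inv_smul_smul₀ ht] at this
    · obtain ⟨r, rfl⟩ := exists_eq_smul_of_not_linearIndependent hx₀0 hli
      have hr : r = 0 := by simpa [ha] using hax
      rwa [hr, zero_smul]
  · push Not at hS
    exact ⟨0, fun x hx => by simp [hS x hx]⟩

theorem isCoatom_ker {ξ : Module.Dual K V} (hξ : ξ ≠ 0) : IsCoatom (LinearMap.ker ξ) :=
  LinearMap.isCoatom_ker_of_surjective (LinearMap.surjective hξ)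

theorem exists_eq_ker_of_isCoatom {H : Submodule K V} (hH : IsCoatom H) :
    ∃ ξ : Module.Dual K V, ξ ≠ 0 ∧ H = LinearMap.ker ξ := by
  obtain ⟨ξ, hξ, hle⟩ := Submodule.exists_le_ker_of_lt_top H hH.lt_top
  exact ⟨ξ, hξ, ((hH.le_iff.1 hle).resolve_left fun h => hξ (LinearMap.ker_eq_top.1 h)).symm⟩

theorem exists_ne_zero_ne_one (hK : Nat.card K ≠ 2) : ∃ t : K, t ≠ 0 ∧ t ≠ 1 := by
  by_contra! h
  refine hK (Nat.card_eq_two_iff.2 ⟨0, 1, zero_ne_one, Set.eq_univ_of_forall fun t => ?_⟩)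
  by_cases ht : t = 0
  · exact Or.inl ht
  · exact Or.inr (h t ht)

end LinearAlgebra

/-! ### From connectedness to proportionality -/

section Flags

variable {K V : Type*} [Field K] [AddCommGroup V] [Module K V]

/-- The labels of a labelling by ratios `g / f` being equal, `g` is a multiple of `f`. -/
theorem FlagLabelling.exists_eq_mul {a : Module.Dual K V → Module.Dual K V} {b : V → V}
    {F : Type*} [Field F] {f g : V → Module.Dual K V → F}
    (H : FlagLabelling a b fun x ξ => g x ξ / f x ξ)
    (hd : 3 ≤ Module.finrank K V) (hd' : (∃ t : K, t ≠ 0 ∧ t ≠ 1) ∨ 4 ≤ Module.finrank K V)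
    (hb : ∀ {x ξ}, x ≠ 0 → ξ ≠ 0 → ξ x = 0 → (f x ξ = 0 ↔ ξ (b x) = 0))
    (hfg : ∀ {x ξ}, x ≠ 0 → ξ ≠ 0 → ξ x = 0 → f x ξ = 0 → g x ξ = 0) :
    ∃ d : F, ∀ x ξ, x ≠ 0 → ξ ≠ 0 → ξ x = 0 → g x ξ = d * f x ξ := by
  by_cases h0 : ∃ (x₀ : V) (ξ₀ : Module.Dual K V), Avoids b x₀ ξ₀
  · obtain ⟨x₀, ξ₀, h0⟩ := h0
    refine ⟨g x₀ ξ₀ / f x₀ ξ₀, fun x ξ hx hξ h => ?_⟩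
    by_cases hf : f x ξ = 0
    · rw [hf, hfg hx hξ h hf, mul_zero]
    · have : g x₀ ξ₀ / f x₀ ξ₀ = g x ξ / f x ξ :=
        H.eq_of_avoids hd hd' h0 ⟨hx, h, fun h' => hf ((hb hx hξ h).2 h')⟩
      rw [this, div_mul_cancel₀ _ hf]
  · push Not at h0
    refine ⟨0, fun x ξ hx hξ h => ?_⟩
    rw [zero_mul]
    refine hfg hx hξ h ((hb hx hξ h).2 ?_)
    by_contra hne
    exact h0 x ξ ⟨hx, h, hne⟩

theorem Avoids.ne_zero {b : V → V} {x : V} {ξ : Module.Dual K V} (h : Avoids b x ξ) : ξ ≠ 0 := by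
  rintro rfl
  exact h.2.2 rfl

end Flags

/-! ### Segre and twisted embeddings -/

section TwistedEmbedding

variable {K V : Type*} [Field K] [AddCommGroup V] [Module K V] {n : ℕ}

theorem coordTwist_add (b : Module.Basis (Fin n) K V) (σ : K ≃+* K) (v w : V) :
    coordTwist b σ (v + w) = coordTwist b σ v + coordTwist b σ w := by
  simp [coordTwist, add_smul, Finset.sum_add_distrib]

theorem coordTwist_smul (b : Module.Basis (Fin n) K V) (σ : K ≃+* K) (r : K) (v : V) :
    coordTwist b σ (r • v) = σ r • coordTwist b σ v := by
  simp [coordTwist, mul_smul, Finset.smul_sum]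

variable [FiniteDimensional K V]

theorem isMinimalCode_phSystem (b : Module.Basis (Fin n) K V) (σ : K ≃+* K)
    (hd : 3 ≤ Module.finrank K V) (hd' : (∃ t : K, t ≠ 0 ∧ t ≠ 1) ∨ 4 ≤ Module.finrank K V) :
    IsMinimalCode (linearCode (phSystem b σ)) := by
  refine isMinimalCode_pointSet fun f g hfg => ?_
  let T := coordTwist b.dualBasis σ
  -- `f (x ⊗ T ξ)` is `σ`-semilinear in `ξ`; applying the inverse of `σ` makes it linear without
  -- changing its zeros.
  let L (f : Module.Dual K (V ⊗[K] Module.Dual K V)) (x : V) : Module.Dual K (Module.Dual K V) :=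
    { toFun := fun ξ => σ.symm (f (x ⊗ₜ[K] T ξ))
      map_add' := fun ξ η => by simp only [T, coordTwist_add, TensorProduct.tmul_add, map_add]
      map_smul' := fun r ξ => by
        simp only [T, coordTwist_smul, TensorProduct.tmul_smul, map_smul, smul_eq_mul, map_mul,
          RingEquiv.symm_apply_apply, RingHom.id_apply] }
  let R (f : Module.Dual K (V ⊗[K] Module.Dual K V)) (ξ : Module.Dual K V) : Module.Dual K V :=
    f ∘ₗ (TensorProduct.mk K V (Module.Dual K V)).flip (T ξ)
  have hL : ∀ x ξ, f (x ⊗ₜ[K] T ξ) = 0 ↔ ξ ((Module.evalEquiv K V).symm (L f x)) = 0 := by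
    intro x ξ
    rw [Module.apply_evalEquiv_symm_apply]
    simp [L]
  have hfg' : ∀ {x : V} {ξ : Module.Dual K V}, x ≠ 0 → ξ ≠ 0 → ξ x = 0 → f (x ⊗ₜ[K] T ξ) = 0 →
      g (x ⊗ₜ[K] T ξ) = 0 := fun {x ξ} hx hξ h => hfg _ ⟨x, ξ, hx, hξ, h, rfl⟩
  have H : FlagLabelling (R f) (fun x => (Module.evalEquiv K V).symm (L f x))
      fun x ξ => g (x ⊗ₜ[K] T ξ) / f (x ⊗ₜ[K] T ξ) := by
    refine ⟨fun {x ξ} _ _ _ => hL x ξ, fun {x ξ η} hξ hη => ?_, fun {x y ξ} hx hy => ?_⟩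
    · obtain ⟨d, hd⟩ := exists_eq_mul_of_forall_mem (LinearMap.ker (Module.Dual.eval K V x))
        (L f x) (L g x) fun ζ hζ hfζ => by
          by_cases hζ0 : ζ = 0
          · rw [hζ0, map_zero]
          · have := hfg' hξ.1 hζ0 hζ (by simpa [L] using hfζ)
            simp [L, this]
      have key : ∀ ζ, Avoids (fun x => (Module.evalEquiv K V).symm (L f x)) x ζ →
          g (x ⊗ₜ[K] T ζ) / f (x ⊗ₜ[K] T ζ) = σ d := by
        intro ζ hζ
        have h1 := hd ζ hζ.2.1
        have h2 : f (x ⊗ₜ[K] T ζ) ≠ 0 := (hL x ζ).not.2 hζ.2.2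
        rw [div_eq_iff h2]
        have h3 := congrArg σ h1
        simpa [L] using h3
      rw [key ξ hξ, key η hη]
    · obtain ⟨d, hd⟩ := exists_eq_mul_of_forall_mem (LinearMap.ker ξ) (R f ξ) (R g ξ)
        fun z hz hfz => by
          by_cases hz0 : z = 0
          · rw [hz0, map_zero]
          · exact hfg' hz0 hx.ne_zero hz hfz
      have key : ∀ z, Avoids (fun x => (Module.evalEquiv K V).symm (L f x)) z ξ →
          g (z ⊗ₜ[K] T ξ) / f (z ⊗ₜ[K] T ξ) = d := fun z hz => by
        rw [div_eq_iff ((hL z ξ).not.2 hz.2.2)]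
        exact hd z hz.2.1
      rw [key x hx, key y hy]
  obtain ⟨d, hd⟩ := H.exists_eq_mul (f := fun x ξ => f (x ⊗ₜ[K] T ξ))
    (g := fun x ξ => g (x ⊗ₜ[K] T ξ)) hd hd' (fun _ _ _ => hL _ _) hfg'
  refine ⟨d, ?_⟩
  rintro _ ⟨x, ξ, hx, hξ, h, rfl⟩
  exact hd x ξ hx hξ h

end TwistedEmbedding

/-! ### Arbitrary projective embeddings -/

section ProjectiveEmbedding

variable {F W : Type*} [Field F] [AddCommGroup W] [Module F W]

theorem rep_mem_of_submodule_le {p : ℙ F W} {T : Submodule F W} (h : p.submodule ≤ T) :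
    p.rep ∈ T := by
  rw [Projectivization.submodule_eq] at h
  exact h (Submodule.mem_span_singleton_self _)

theorem submodule_mk_le {v : W} (hv : v ≠ 0) {T : Submodule F W} (h : v ∈ T) :
    (Projectivization.mk F v hv).submodule ≤ T := by
  rw [Projectivization.submodule_mk]
  exact (Submodule.span_singleton_le_iff_mem _ _).2 h

theorem apply_mk_rep_eq_zero (f : Module.Dual F W) {v : W} (hv : v ≠ 0) :
    f (Projectivization.mk F v hv).rep = 0 ↔ f v = 0 := by
  obtain ⟨a, ha⟩ := Projectivization.exists_smul_eq_mk_rep F v hv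
  rw [← ha, Units.smul_def, map_smul, smul_eq_zero]
  simp

namespace IsProjectiveEmbedding

variable {P : Type*} {L : Set (Set P)} {ε : P → ℙ F W}

theorem exists_apply_eq_zero (hε : IsProjectiveEmbedding L ε) (f : Module.Dual F W) {l : Set P}
    (hl : l ∈ L) : ∃ p ∈ l, f (ε p).rep = 0 := by
  obtain ⟨T, hT, hl⟩ := hε.map_line l hl
  have : FiniteDimensional F T := Module.finite_of_finrank_pos (by omega)
  obtain ⟨w, hw, hw0⟩ := (LinearMap.ker (f.domRestrict T)).exists_mem_ne_zero_of_ne_bot (by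
    intro h
    have h1 := (f.domRestrict T).finrank_range_add_finrank_ker
    have h2 := (LinearMap.range (f.domRestrict T)).finrank_le
    rw [h, finrank_bot] at h1
    rw [Module.finrank_self] at h2
    omega)
  have hw0' : (w : W) ≠ 0 := fun h => hw0 (Subtype.ext h)
  have : Projectivization.mk F (w : W) hw0' ∈ ε '' l := by
    rw [hl]
    exact submodule_mk_le hw0' w.2
  obtain ⟨p, hp, hpw⟩ := this
  exact ⟨p, hp, by rw [hpw, apply_mk_rep_eq_zero]; exact hw⟩

theorem apply_eq_zero_of_line (hε : IsProjectiveEmbedding L ε) (f : Module.Dual F W) {l : Set P}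
    (hl : l ∈ L) {p q r : P} (hp : p ∈ l) (hq : q ∈ l) (hr : r ∈ l) (hpq : p ≠ q)
    (hfp : f (ε p).rep = 0) (hfq : f (ε q).rep = 0) : f (ε r).rep = 0 := by
  obtain ⟨T, hT, hl⟩ := hε.map_line l hl
  have : FiniteDimensional F T := Module.finite_of_finrank_pos (by omega)
  have hmem : ∀ s ∈ l, (ε s).rep ∈ T := fun s hs => by
    have : ε s ∈ ε '' l := ⟨s, hs, rfl⟩
    rw [hl] at this
    exact rep_mem_of_submodule_le this
  have hli : LinearIndependent F ![(ε p).rep, (ε q).rep] := by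
    rw [Projectivization.linearIndependent_pair_iff_ne]
    exact fun h => hpq (hε.injective h)
  have hspan : Submodule.span F (Set.range ![(ε p).rep, (ε q).rep]) = T := by
    refine Submodule.eq_of_le_of_finrank_eq (Submodule.span_le.2 ?_) ?_
    · rintro _ ⟨i, rfl⟩
      fin_cases i
      · exact hmem p hp
      · exact hmem q hq
    · rw [finrank_span_eq_card hli, hT, Fintype.card_fin]
  have hle : T ≤ LinearMap.ker f := by
    rw [← hspan, Submodule.span_le]
    rintro _ ⟨i, rfl⟩
    fin_cases i
    · exact hfp
    · exact hfq
  exact hle (hmem r hr)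

/-- On the two-dimensional space carrying the line, zeros of `f` are zeros of `g`, because every
point of that space is an image point. Hence `g` is a multiple of `f` there. -/
theorem div_eq_of_line (hε : IsProjectiveEmbedding L ε) {f g : Module.Dual F W}
    (hfg : ∀ p, f (ε p).rep = 0 → g (ε p).rep = 0) {l : Set P} (hl : l ∈ L) {p q : P}
    (hp : p ∈ l) (hq : q ∈ l) (hfp : f (ε p).rep ≠ 0) (hfq : f (ε q).rep ≠ 0) :
    g (ε p).rep / f (ε p).rep = g (ε q).rep / f (ε q).rep := by
  obtain ⟨T, hT, hl⟩ := hε.map_line l hl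
  have hmem : ∀ s ∈ l, (ε s).rep ∈ T := fun s hs => by
    have : ε s ∈ ε '' l := ⟨s, hs, rfl⟩
    rw [hl] at this
    exact rep_mem_of_submodule_le this
  obtain ⟨c, hc⟩ := exists_eq_mul_of_forall_mem T f g fun v hv hfv => by
    by_cases hv0 : v = 0
    · rw [hv0, map_zero]
    have : Projectivization.mk F v hv0 ∈ ε '' l := by
      rw [hl]
      exact submodule_mk_le hv0 hv
    obtain ⟨s, -, hs⟩ := this
    rw [← apply_mk_rep_eq_zero g hv0, ← hs]
    refine hfg s ?_
    rwa [hs, apply_mk_rep_eq_zero]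
  rw [hc _ (hmem p hp), hc _ (hmem q hq), mul_div_cancel_right₀ _ hfp, mul_div_cancel_right₀ _ hfq]

end IsProjectiveEmbedding

variable {K V : Type*} [Field K] [AddCommGroup V] [Module K V]

/-- The flag of the point `[x]` and the hyperplane `[ker ξ]`. -/
noncomputable def flag (x : V) (ξ : Module.Dual K V) (h : x ≠ 0 ∧ ξ ≠ 0 ∧ ξ x = 0) :
    PHPoint K V :=
  ⟨(Projectivization.mk K x h.1, LinearMap.ker ξ), isCoatom_ker h.2.1, submodule_mk_le h.1 h.2.2⟩

theorem flag_eq_flag {x y : V} {ξ η : Module.Dual K V} {h : x ≠ 0 ∧ ξ ≠ 0 ∧ ξ x = 0}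
    {h' : y ≠ 0 ∧ η ≠ 0 ∧ η y = 0} :
    flag x ξ h = flag y η h' ↔ (∃ r : K, y = r • x) ∧ ∃ r : K, η = r • ξ := by
  have hiff : flag x ξ h = flag y η h' ↔
      Projectivization.mk K x h.1 = Projectivization.mk K y h'.1 ∧ LinearMap.ker ξ = LinearMap.ker η := Subtype.ext_iff.trans Prod.ext_iff
  rw [hiff, eq_comm, Projectivization.mk_eq_mk_iff']
  refine and_congr (exists_congr fun _ => eq_comm) ⟨fun hk => ?_, ?_⟩
  · exact exists_eq_smul_of_ker_le _ _ fun v hv => (hk ▸ hv : v ∈ LinearMap.ker η)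
  · rintro ⟨r, rfl⟩
    have hr : r ≠ 0 := fun hr => h'.2.1 (by rw [hr, zero_smul])
    exact (LinearMap.ker_smul ξ r hr).symm

theorem exists_eq_flag (p : PHPoint K V) : ∃ x ξ h, p = flag x ξ h := by
  obtain ⟨⟨p, H⟩, hH, hp⟩ := p
  obtain ⟨ξ, hξ, rfl⟩ := exists_eq_ker_of_isCoatom hH
  exact ⟨p.rep, ξ, ⟨p.rep_nonzero, hξ, rep_mem_of_submodule_le hp⟩,
    Subtype.ext (Prod.ext p.mk_rep.symm rfl)⟩

/-- The line of all flags `(p, ker ξ)` with `p` on the line spanned by `x` and `y`. -/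
theorem exists_line_of_points {x y : V} {ξ : Module.Dual K V} (hξ : ξ ≠ 0) (hx : ξ x = 0)
    (hy : ξ y = 0) (hli : LinearIndependent K ![x, y]) :
    ∃ l ∈ phLines K V, (∀ s t : K, ∀ h, flag (s • x + t • y) ξ h ∈ l) ∧
      ∀ p ∈ l, ∃ (s t : K) (h : _), p = flag (s • x + t • y) ξ h := by
  have hr : Submodule.span K (Set.range ![x, y]) = Submodule.span K {x, y} := by
    rw [Matrix.range_cons, Matrix.range_cons, Matrix.range_empty, Set.union_empty,
      Set.singleton_union]
  refine ⟨_, Or.inl ⟨Submodule.span K {x, y}, LinearMap.ker ξ, ?_, isCoatom_ker hξ, ?_, rfl⟩, ?_,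
    ?_⟩
  · rw [← hr, finrank_span_eq_card hli, Fintype.card_fin]
  · rw [Submodule.span_le]
    rintro _ (rfl | rfl)
    · exact hx
    · exact hy
  · exact fun s t h => ⟨submodule_mk_le h.1 (Submodule.mem_span_pair.2 ⟨s, t, rfl⟩), rfl⟩
  · rintro p ⟨hp1, hp2⟩
    obtain ⟨z, ζ, h, rfl⟩ := exists_eq_flag p
    obtain ⟨s, t, rfl⟩ := Submodule.mem_span_pair.1
      (hp1 (by rw [flag, Projectivization.submodule_mk]; exact Submodule.mem_span_singleton_self z))
    have hp2 : LinearMap.ker ζ = LinearMap.ker ξ := hp2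
    refine ⟨s, t, ⟨h.1, hξ, by simp [hx, hy]⟩, flag_eq_flag.2 ⟨⟨1, (one_smul _ _).symm⟩, ?_⟩⟩
    exact exists_eq_smul_of_ker_le _ _ fun v hv => (hp2 ▸ hv : v ∈ LinearMap.ker ξ)

/-- The line of all flags `([x], H)` with `H` in the pencil spanned by `ξ` and `η`. -/
theorem exists_line_of_hyperplanes [FiniteDimensional K V] {x : V} {ξ η : Module.Dual K V}
    (hx : x ≠ 0) (hξ : ξ x = 0) (hη : η x = 0) (hli : LinearIndependent K ![ξ, η]) :
    ∃ l ∈ phLines K V, (∀ s t : K, ∀ h, flag x (s • ξ + t • η) h ∈ l) ∧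
      ∀ p ∈ l, ∃ (s t : K) (h : _), p = flag x (s • ξ + t • η) h := by
  have hr : Submodule.span K (Set.range ![ξ, η]) = Submodule.span K {ξ, η} := by
    rw [Matrix.range_cons, Matrix.range_cons, Matrix.range_empty, Set.union_empty,
      Set.singleton_union]
  set D := Submodule.span K {ξ, η} with hD
  have hmem : ∀ v, (∀ ζ ∈ D, ζ v = 0) → v ∈ D.dualCoannihilator := fun v hv =>
    (Submodule.mem_dualCoannihilator v).2 hv
  refine ⟨_, Or.inr ⟨Projectivization.mk K x hx, D.dualCoannihilator, ?_, ?_, rfl⟩, ?_, ?_⟩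
  · have h1 := Subspace.finrank_add_finrank_dualCoannihilator_eq D
    have h2 := D.dualCoannihilator.finrank_quotient_add_finrank
    rw [← hr, finrank_span_eq_card hli, Fintype.card_fin, hr] at h1
    omega
  · refine submodule_mk_le hx (hmem x fun ζ hζ => ?_)
    obtain ⟨s, t, rfl⟩ := Submodule.mem_span_pair.1 hζ
    simp [hξ, hη]
  · refine fun s t h => ⟨rfl, fun v hv => ?_⟩
    exact (Submodule.mem_dualCoannihilator v).1 hv _ (Submodule.mem_span_pair.2 ⟨s, t, rfl⟩)
  · rintro p ⟨hp1, hp2⟩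
    obtain ⟨z, ζ, h, rfl⟩ := exists_eq_flag p
    have hζ : ζ ∈ D := by
      rw [← Subspace.dualCoannihilator_dualAnnihilator_eq (W := D), Submodule.mem_dualAnnihilator]
      exact fun v hv => hp2 hv
    obtain ⟨s, t, rfl⟩ := Submodule.mem_span_pair.1 hζ
    obtain ⟨r, hr⟩ := (Projectivization.mk_eq_mk_iff' K _ _ _ _).1 hp1.symm
    refine ⟨s, t, ⟨hx, h.2.1, by simp [hξ, hη]⟩, flag_eq_flag.2 ⟨⟨r, hr.symm⟩, 1, ?_⟩⟩
    rw [one_smul]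

open Classical in
/-- A function of flags, as a function of pairs. -/
noncomputable def flagFun (φ : PHPoint K V → F) (x : V) (ξ : Module.Dual K V) : F :=
  -- The default 0 makes the zero vector belong to the zero set, as `exists_dual_iff` requires.
  if h : x ≠ 0 ∧ ξ ≠ 0 ∧ ξ x = 0 then φ (flag x ξ h) else 0

theorem flagFun_of (φ : PHPoint K V → F) {x : V} {ξ : Module.Dual K V}
    (h : x ≠ 0 ∧ ξ ≠ 0 ∧ ξ x = 0) : flagFun φ x ξ = φ (flag x ξ h) := dif_pos h

theorem flagFun_smul_left (φ : PHPoint K V → F) {x : V} {ξ : Module.Dual K V} {r : K}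
    (hr : r ≠ 0) : flagFun φ (r • x) ξ = flagFun φ x ξ := by
  by_cases h : x ≠ 0 ∧ ξ ≠ 0 ∧ ξ x = 0
  · rw [flagFun_of φ h, flagFun_of φ (by simpa [hr] using h)]
    exact congrArg φ (flag_eq_flag.2 ⟨⟨r, rfl⟩, 1, (one_smul _ _).symm⟩).symm
  · rw [flagFun, flagFun, dif_neg h, dif_neg (by simpa [hr] using h)]

theorem flagFun_smul_right (φ : PHPoint K V → F) {x : V} {ξ : Module.Dual K V} {r : K}
    (hr : r ≠ 0) : flagFun φ x (r • ξ) = flagFun φ x ξ := by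
  by_cases h : x ≠ 0 ∧ ξ ≠ 0 ∧ ξ x = 0
  · rw [flagFun_of φ h, flagFun_of φ (by simpa [hr] using h)]
    exact congrArg φ (flag_eq_flag.2 ⟨⟨1, (one_smul _ _).symm⟩, r, rfl⟩).symm
  · rw [flagFun, flagFun, dif_neg h, dif_neg (by simpa [hr] using h)]

variable [FiniteDimensional K V]

theorem isMinimalCode_range_embedding {ε : PHPoint K V → ℙ F W}
    (hε : IsProjectiveEmbedding (phLines K V) ε)
    (hd : 3 ≤ Module.finrank K V) (hd' : (∃ t : K, t ≠ 0 ∧ t ≠ 1) ∨ 4 ≤ Module.finrank K V) :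
    IsMinimalCode (linearCode (Set.range ε)) := by
  refine isMinimalCode_linearCode fun f g hfg => ?_
  replace hfg : ∀ p, f (ε p).rep = 0 → g (ε p).rep = 0 := fun p => hfg _ ⟨p, rfl⟩
  set φ : PHPoint K V → F := fun p => f (ε p).rep
  set γ : PHPoint K V → F := fun p => g (ε p).rep
  -- The embedding gives no linear dependence of `f` on `x` or `ξ`, and `F` may differ from `K`.
  -- Only the incidence of the zero set with lines is used, and it suffices to produce `a` and `b`
  -- over `K`.
  have ha : ∀ ξ : Module.Dual K V, ξ ≠ 0 → ∃ a : Module.Dual K V,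
      ∀ x ∈ LinearMap.ker ξ, flagFun φ x ξ = 0 ↔ a x = 0 := by
    intro ξ hξ
    refine exists_dual_iff _ _ (dif_neg (by simp)) ?_ ?_ ?_
    · intro x _ r h
      by_cases hr : r = 0
      · rw [hr, zero_smul]
        exact dif_neg (by simp)
      · rwa [flagFun_smul_left φ hr]
    · intro x hx y hy hli h1 h2
      obtain ⟨l, hl, hl1, -⟩ := exists_line_of_points hξ hx hy hli
      have hx' : x ≠ 0 ∧ ξ ≠ 0 ∧ ξ x = 0 := ⟨hli.ne_zero 0, hξ, hx⟩
      have hy' : y ≠ 0 ∧ ξ ≠ 0 ∧ ξ y = 0 := ⟨hli.ne_zero 1, hξ, hy⟩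
      have hxy : x + y ≠ 0 ∧ ξ ≠ 0 ∧ ξ (x + y) = 0 :=
        ⟨fun h => one_ne_zero (LinearIndependent.pair_iff.1 hli 1 1 (by simpa using h)).1, hξ,
          (LinearMap.ker ξ).add_mem hx hy⟩
      rw [flagFun_of φ hx'] at h1
      rw [flagFun_of φ hy'] at h2
      rw [flagFun_of φ hxy]
      refine hε.apply_eq_zero_of_line f hl (p := flag x ξ hx') (q := flag y ξ hy') ?_ ?_ ?_ ?_ h1 h2
      · simpa using hl1 1 0 (by simpa using hx')
      · simpa using hl1 0 1 (by simpa using hy')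
      · simpa using hl1 1 1 (by simpa using hxy)
      · rw [Ne, flag_eq_flag]
        rintro ⟨⟨r, hr⟩, -⟩
        exact ((LinearIndependent.pair_iff' hx'.1).1 hli r) hr.symm
    · intro x hx y hy hli
      obtain ⟨l, hl, -, hl2⟩ := exists_line_of_points hξ hx hy hli
      obtain ⟨p, hp, hfp⟩ := hε.exists_apply_eq_zero f hl
      obtain ⟨s, t, h, rfl⟩ := hl2 p hp
      exact ⟨s, t, h.1, by rwa [flagFun_of φ h]⟩
  have hb : ∀ x : V, x ≠ 0 → ∃ b : V, ∀ ξ : Module.Dual K V, ξ x = 0 →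
      (flagFun φ x ξ = 0 ↔ ξ b = 0) := by
    intro x hx
    obtain ⟨b, hb⟩ := exists_dual_iff (LinearMap.ker (Module.Dual.eval K V x))
      (fun ξ => flagFun φ x ξ = 0) (dif_neg (by simp))
      (by
        intro ξ _ r h
        by_cases hr : r = 0
        · rw [hr, zero_smul]
          exact dif_neg (by simp)
        · rwa [flagFun_smul_right φ hr])
      (by
        intro ξ hξ η hη hli h1 h2
        obtain ⟨l, hl, hl1, -⟩ := exists_line_of_hyperplanes hx hξ hη hli
        have hξ' : x ≠ 0 ∧ ξ ≠ 0 ∧ ξ x = 0 := ⟨hx, hli.ne_zero 0, hξ⟩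
        have hη' : x ≠ 0 ∧ η ≠ 0 ∧ η x = 0 := ⟨hx, hli.ne_zero 1, hη⟩
        have hξη : x ≠ 0 ∧ ξ + η ≠ 0 ∧ (ξ + η) x = 0 :=
          ⟨hx, fun h => one_ne_zero (LinearIndependent.pair_iff.1 hli 1 1 (by simpa using h)).1,
            by rw [LinearMap.add_apply, hξ'.2.2, hη'.2.2, add_zero]⟩
        rw [flagFun_of φ hξ'] at h1
        rw [flagFun_of φ hη'] at h2
        rw [flagFun_of φ hξη]
        refine hε.apply_eq_zero_of_line f hl (p := flag x ξ hξ') (q := flag x η hη') ?_ ?_ ?_ ?_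
          h1 h2
        · simpa using hl1 1 0 (by simpa using hξ')
        · simpa using hl1 0 1 (by simpa using hη')
        · simpa using hl1 1 1 (by simpa using hξη)
        · rw [Ne, flag_eq_flag]
          rintro ⟨-, r, hr⟩
          exact ((LinearIndependent.pair_iff' hξ'.2.1).1 hli r) hr.symm)
      (by
        intro ξ hξ η hη hli
        obtain ⟨l, hl, -, hl2⟩ := exists_line_of_hyperplanes (ξ := ξ) (η := η) hx hξ hη hli
        obtain ⟨p, hp, hfp⟩ := hε.exists_apply_eq_zero f hl
        obtain ⟨s, t, h, rfl⟩ := hl2 p hp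
        exact ⟨s, t, h.2.1, by rwa [flagFun_of φ h]⟩)
    refine ⟨(Module.evalEquiv K V).symm b, fun ξ hξ => ?_⟩
    rw [Module.apply_evalEquiv_symm_apply]
    exact hb ξ hξ
  choose! a ha using ha
  choose! b hb using hb
  have H : FlagLabelling a b fun x ξ => flagFun γ x ξ / flagFun φ x ξ := by
    refine ⟨fun {x ξ} hx hξ h => (ha ξ hξ x h).symm.trans (hb x hx ξ h), fun {x ξ η} h1 h2 => ?_,
      fun {x y ξ} h1 h2 => ?_⟩
    · have hξ : x ≠ 0 ∧ ξ ≠ 0 ∧ ξ x = 0 := ⟨h1.1, h1.ne_zero, h1.2.1⟩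
      have hη : x ≠ 0 ∧ η ≠ 0 ∧ η x = 0 := ⟨h2.1, h2.ne_zero, h2.2.1⟩
      have hfξ := (hb x h1.1 ξ h1.2.1).not.2 h1.2.2
      have hfη := (hb x h2.1 η h2.2.1).not.2 h2.2.2
      by_cases hli : LinearIndependent K ![ξ, η]
      · obtain ⟨l, hl, hl1, -⟩ := exists_line_of_hyperplanes h1.1 h1.2.1 h2.2.1 hli
        rw [flagFun_of φ hξ] at hfξ ⊢
        rw [flagFun_of φ hη] at hfη ⊢
        rw [flagFun_of γ hξ, flagFun_of γ hη]
        refine hε.div_eq_of_line hfg hl ?_ ?_ hfξ hfη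
        · simpa using hl1 1 0 (by simpa using hξ)
        · simpa using hl1 0 1 (by simpa using hη)
      · obtain ⟨r, rfl⟩ := exists_eq_smul_of_not_linearIndependent hξ.2.1 hli
        have hr : r ≠ 0 := fun hr => hη.2.1 (by rw [hr, zero_smul])
        rw [flagFun_smul_right φ hr, flagFun_smul_right γ hr]
    · have hx : x ≠ 0 ∧ ξ ≠ 0 ∧ ξ x = 0 := ⟨h1.1, h1.ne_zero, h1.2.1⟩
      have hy : y ≠ 0 ∧ ξ ≠ 0 ∧ ξ y = 0 := ⟨h2.1, h2.ne_zero, h2.2.1⟩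
      have hfx := (hb x h1.1 ξ h1.2.1).not.2 h1.2.2
      have hfy := (hb y h2.1 ξ h2.2.1).not.2 h2.2.2
      by_cases hli : LinearIndependent K ![x, y]
      · obtain ⟨l, hl, hl1, -⟩ := exists_line_of_points hx.2.1 hx.2.2 hy.2.2 hli
        rw [flagFun_of φ hx] at hfx ⊢
        rw [flagFun_of φ hy] at hfy ⊢
        rw [flagFun_of γ hx, flagFun_of γ hy]
        refine hε.div_eq_of_line hfg hl ?_ ?_ hfx hfy
        · simpa using hl1 1 0 (by simpa using hx)
        · simpa using hl1 0 1 (by simpa using hy)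
      · obtain ⟨r, rfl⟩ := exists_eq_smul_of_not_linearIndependent hx.1 hli
        have hr : r ≠ 0 := fun hr => hy.1 (by rw [hr, zero_smul])
        rw [flagFun_smul_left φ hr, flagFun_smul_left γ hr]
  obtain ⟨d, hd⟩ := H.exists_eq_mul hd hd' (fun {x ξ} hx _ h => hb x hx ξ h)
    (fun {x ξ} hx hξ h hf => by
      rw [flagFun_of φ ⟨hx, hξ, h⟩] at hf
      rw [flagFun_of γ ⟨hx, hξ, h⟩]
      exact hfg _ hf)
  refine ⟨d, ?_⟩
  rintro _ ⟨p, rfl⟩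
  obtain ⟨x, ξ, h, rfl⟩ := exists_eq_flag p
  have := hd x ξ h.1 h.2.1 h.2.2
  rwa [flagFun_of φ h, flagFun_of γ h] at this

end ProjectiveEmbedding

/-! ### Quadratic and Hermitian forms as polar forms -/

section Polar

variable {K V : Type*} [Field K] [AddCommGroup V] [Module K V]

theorem exists_le_finrank_of_le_wittIndex {iso : Submodule K V → Prop} {d : ℕ} (hd : d ≠ 0)
    (h : d ≤ wittIndex iso) : ∃ U, iso U ∧ d ≤ Module.finrank K U := by
  -- As `d ≠ 0`, the number `d - 1` is strictly below the supremum, which yields an actual subspace.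
  obtain ⟨_, ⟨U, hU, rfl⟩, hlt⟩ := exists_lt_of_lt_csSup' (show d - 1 < wittIndex iso by omega)
  exact ⟨U, hU, by omega⟩

theorem altIsotropic_span_pair {B : LinearMap.BilinForm K V} (hB : B.IsAlt) (x y : V) :
    AltIsotropic B (Submodule.span K {x, y}) ↔ B x y = 0 := by
  refine ⟨fun h => h x (Submodule.subset_span (by simp)) y (Submodule.subset_span (by simp)),
    fun h v hv w hw => ?_⟩
  obtain ⟨a, b, rfl⟩ := Submodule.mem_span_pair.1 hv
  obtain ⟨c, d, rfl⟩ := Submodule.mem_span_pair.1 hw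
  simp [hB x, hB y, h, hB.isRefl x y h]

/-- The polar form of a non-degenerate quadratic form. -/
def PolarForm.ofQuadratic (Q : QuadraticForm K V) (hQ : QuadNondegenerate Q) {t : K}
    (ht0 : t ≠ 0) (ht1 : t ≠ 1) : PolarForm K V where
  form x := Q.polarBilin x
  twist := RingEquiv.refl K
  sing x := Q x = 0
  form_add x y := map_add _ x y
  form_smul a x := map_smul _ a x
  form_symm {x y} h := by
    rw [QuadraticMap.polarBilin_apply_apply] at h ⊢
    rwa [QuadraticMap.polar_comm]
  form_self {x} h := by
    rw [QuadraticMap.polarBilin_apply_apply, QuadraticMap.polar_self, h, smul_zero]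
  sing_comb {x y} a b hx hy h := by
    rw [QuadraticMap.polarBilin_apply_apply] at h
    rw [QuadraticMap.map_add Q, QuadraticMap.map_smul, QuadraticMap.map_smul, hx, hy,
      QuadraticMap.polar_smul_left, QuadraticMap.polar_smul_right, h]
    simp
  eq_zero {x} hx h := hQ x hx h
  exists_sing_add {v w} hw h := by
    rw [QuadraticMap.polarBilin_apply_apply] at h
    refine ⟨-(Q v / QuadraticMap.polar Q v w), ?_⟩
    rw [QuadraticMap.map_add Q, QuadraticMap.map_smul, hw, QuadraticMap.polar_smul_right,
      smul_eq_mul, smul_eq_mul]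
    field_simp
    ring
  twist_sep c d h := by
    have := h t
    rw [RingEquiv.refl_apply] at this
    exact mul_left_cancel₀ (mul_ne_zero ht0 (sub_ne_zero.2 ht1)) this

theorem quadSingular_span_pair (Q : QuadraticForm K V) (x y : V) :
    QuadSingular Q (Submodule.span K {x, y}) ↔ Q x = 0 ∧ Q y = 0 ∧ Q.polarBilin x y = 0 := by
  have hx : x ∈ Submodule.span K {x, y} := Submodule.subset_span (by simp)
  have hy : y ∈ Submodule.span K {x, y} := Submodule.subset_span (by simp)
  rw [QuadraticMap.polarBilin_apply_apply]
  refine ⟨fun h => ⟨h x hx, h y hy, ?_⟩, fun ⟨h1, h2, h3⟩ v hv => ?_⟩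
  · rw [QuadraticMap.polar, h x hx, h y hy, h _ (Submodule.add_mem _ hx hy)]
    simp
  · obtain ⟨a, b, rfl⟩ := Submodule.mem_span_pair.1 hv
    rw [QuadraticMap.map_add Q, QuadraticMap.map_smul, QuadraticMap.map_smul, h1, h2,
      QuadraticMap.polar_smul_left, QuadraticMap.polar_smul_right, h3]
    simp

theorem QuadSingular.ts {Q : QuadraticForm K V} {hQ : QuadNondegenerate Q} {t : K} {ht0 : t ≠ 0}
    {ht1 : t ≠ 1} {U : Submodule K V} (hU : QuadSingular Q U) :
    (PolarForm.ofQuadratic Q hQ ht0 ht1).TS U := by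
  refine fun x hx y hy => ⟨hU x hx, ?_⟩
  change Q.polarBilin x y = 0
  rw [QuadraticMap.polarBilin_apply_apply, QuadraticMap.polar, hU x hx, hU y hy,
    hU _ (U.add_mem hx hy)]
  simp

/-- The trace of an involution has a value different from zero. -/
theorem exists_add_ne_zero {σ : K ≃+* K} (hσ : σ ≠ RingEquiv.refl K) : ∃ a, a + σ a ≠ 0 := by
  by_contra! h
  refine hσ (RingEquiv.ext fun a => ?_)
  have h1 := h 1
  have h2 := h a
  rw [map_one] at h1
  rw [RingEquiv.refl_apply]
  linear_combination h2 - a * h1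

theorem twist_sep_of_involution {σ : K ≃+* K} (hσ : σ ≠ RingEquiv.refl K)
    (hinv : ∀ a, σ (σ a) = a) (c d : K)
    (h : ∀ t, t * (σ t - 1) * c = σ t * (t - 1) * d) : c = d := by
  -- The value `t = -1` settles odd characteristic. In characteristic two, subtract the identities
  -- for `t` and `σ t` with `σ t ≠ t`.
  have hm := h (-1)
  rw [map_neg, map_one] at hm
  have h2 : (2 : K) * (c - d) = 0 := by linear_combination hm
  by_cases h0 : (2 : K) = 0
  · obtain ⟨t, ht⟩ : ∃ t, σ t ≠ t := by
      by_contra! h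
      exact hσ (RingEquiv.ext h)
    have e1 := h t
    have e2 := h (σ t)
    rw [hinv] at e2
    have : (σ t - t) * (c + d) = 0 := by linear_combination e1 - e2
    have := (mul_eq_zero.1 this).resolve_left (sub_ne_zero.2 ht)
    linear_combination this - d * h0
  · exact sub_eq_zero.1 ((mul_eq_zero.1 h2).resolve_left h0)

/-- The polar form given by a non-degenerate Hermitian form. -/
def PolarForm.ofHermitian {σ : K ≃+* K} {h : V →ₛₗ[(σ : K →+* K)] V →ₗ[K] K}
    (hh : IsHermitianForm σ h) : PolarForm K V where
  form := h
  twist := σ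
  sing x := h x x = 0
  form_add x y := map_add h x y
  form_smul a x := map_smulₛₗ h a x
  form_symm {x y} h0 := by rw [← hh.symm, h0, map_zero]
  form_self h0 := h0
  sing_comb {x y} a b hx hy hxy := by
    have hyx : h y x = 0 := by rw [← hh.symm, hxy, map_zero]
    simp [hx, hy, hxy, hyx]
  eq_zero {x} _ h0 := hh.nondeg x h0
  exists_sing_add {v w} hw h0 := by
    obtain ⟨a, ha⟩ := exists_add_ne_zero hh.ne_id
    have hs : σ (h v v) = h v v := hh.symm v v
    have ht : σ (a + σ a) = a + σ a := by rw [map_add, hh.invol, add_comm]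
    -- The coefficient times `h v w` must have trace `-h v v`; since `h v v` and `a + σ a` are fixed
    -- by `σ`, scaling `a` achieves this.
    refine ⟨-(h v v * a / (a + σ a)) / h v w, ?_⟩
    have hwv : h w v = σ (h v w) := (hh.symm v w).symm
    have h0' : σ (h v w) ≠ 0 := (map_ne_zero σ).2 h0
    simp only [map_add, map_smulₛₗ, LinearMap.add_apply, LinearMap.smul_apply, smul_eq_mul, hw,
      mul_zero, add_zero, hwv, RingHom.id_apply, RingEquiv.coe_toRingHom, map_div₀, map_neg,
      map_mul, hs, hh.invol, add_comm (σ a) a]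
    field_simp
    ring
  twist_sep := twist_sep_of_involution hh.ne_id hh.invol

theorem hermIsotropic_span_pair {σ : K ≃+* K} {h : V →ₛₗ[(σ : K →+* K)] V →ₗ[K] K}
    (hh : IsHermitianForm σ h) (x y : V) :
    HermIsotropic h (Submodule.span K {x, y}) ↔ h x x = 0 ∧ h y y = 0 ∧ h x y = 0 := by
  have hx : x ∈ Submodule.span K {x, y} := Submodule.subset_span (by simp)
  have hy : y ∈ Submodule.span K {x, y} := Submodule.subset_span (by simp)
  refine ⟨fun h => ⟨h x hx x hx, h y hy y hy, h x hx y hy⟩, fun ⟨h1, h2, h3⟩ v hv w hw => ?_⟩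
  have h4 : h y x = 0 := by rw [← hh.symm, h3, map_zero]
  obtain ⟨a, b, rfl⟩ := Submodule.mem_span_pair.1 hv
  obtain ⟨c, d, rfl⟩ := Submodule.mem_span_pair.1 hw
  simp [h1, h2, h3, h4]

variable [FiniteDimensional K V]

theorem PolarForm.isMinimalCode (P : PolarForm K V) {iso : Submodule K V → Prop}
    (hiso : ∀ x y, iso (Submodule.span K {x, y}) ↔ P.sing x ∧ P.sing y ∧ P.form x y = 0)
    {U : Submodule K V} (hU : P.TS U) (hr : 3 ≤ Module.finrank K U) :
    IsMinimalCode (polarGrassmannCode iso 2) := by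
  refine isMinimalCode_polarGrassmannCode_two hiso fun f g hf hg hfg => ?_
  obtain ⟨c, hc⟩ := hU.exists_eq_mul hr hf hg fun x y hx hy hxy => hfg x y ⟨hx, hy, hxy⟩
  exact ⟨c, fun x y h => hc x y h.1 h.2.1 h.2.2⟩

end Polar

end EmbCode

theorem theorem1p3 {K : Type*} [Field K] [Finite K] :
    -- Grassmann codes
    (∀ (V : Type*) [AddCommGroup V] [Module K V] [FiniteDimensional K V] (k : ℕ),
      1 ≤ k → k + 1 ≤ Module.finrank K V →
      EmbCode.IsMinimalCode (EmbCode.grassmannCode K V k)) ∧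
    -- Segre codes
    (∀ (V₁ V₂ : Type*) [AddCommGroup V₁] [Module K V₁] [FiniteDimensional K V₁]
      [AddCommGroup V₂] [Module K V₂] [FiniteDimensional K V₂],
      EmbCode.IsMinimalCode (EmbCode.segreCode K V₁ V₂)) ∧
    -- line symplectic Grassmann codes
    (∀ (V : Type*) [AddCommGroup V] [Module K V] [FiniteDimensional K V]
      (B : LinearMap.BilinForm K V), Nat.card K ≠ 2 → B.IsAlt → B.Nondegenerate →
      2 ≤ EmbCode.wittIndex (EmbCode.AltIsotropic B) →
      EmbCode.IsMinimalCode (EmbCode.polarGrassmannCode (EmbCode.AltIsotropic B) 2)) ∧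
    -- line orthogonal Grassmann codes
    (∀ (V : Type*) [AddCommGroup V] [Module K V] [FiniteDimensional K V]
      (Q : QuadraticForm K V), Nat.card K ≠ 2 → EmbCode.QuadNondegenerate Q →
      3 ≤ EmbCode.wittIndex (EmbCode.QuadSingular Q) →
      EmbCode.IsMinimalCode (EmbCode.polarGrassmannCode (EmbCode.QuadSingular Q) 2)) ∧
    -- line Hermitian Grassmann codes
    (∀ (V : Type*) [AddCommGroup V] [Module K V] [FiniteDimensional K V]
      (σ : K ≃+* K) (h : V →ₛₗ[(σ : K →+* K)] V →ₗ[K] K), EmbCode.IsHermitianForm σ h →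
      3 ≤ EmbCode.wittIndex (EmbCode.HermIsotropic h) →
      EmbCode.IsMinimalCode (EmbCode.polarGrassmannCode (EmbCode.HermIsotropic h) 2)) ∧
    -- codes from the point-hyperplane geometry of `PG(V)`
    (∀ (V : Type*) [AddCommGroup V] [Module K V] [FiniteDimensional K V] (n : ℕ),
      Module.finrank K V = n + 1 → 2 ≤ n → ¬ (n = 2 ∧ Nat.card K = 2) →
      -- from an arbitrary projective embedding
      (∀ (F W : Type*) [Field F] [Finite F] [AddCommGroup W] [Module F W]
        (ε : EmbCode.PHPoint K V → ℙ F W),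
        EmbCode.IsProjectiveEmbedding (EmbCode.phLines K V) ε →
        EmbCode.IsMinimalCode (EmbCode.linearCode (Set.range ε))) ∧
      -- from the Segre embedding and the twisted embeddings
      (∀ (b : Module.Basis (Fin (n + 1)) K V) (σ : K ≃+* K),
        EmbCode.IsMinimalCode (EmbCode.linearCode (EmbCode.phSystem b σ)))) := by
  refine ⟨?_, ?_, ?_, ?_, ?_, ?_⟩
  · intro V _ _ _ k _ _
    exact EmbCode.isMinimalCode_grassmannCode k
  · intro V₁ V₂ _ _ _ _ _ _
    exact EmbCode.isMinimalCode_segreCode V₁ V₂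
  · intro V _ _ _ B _ hB hB' _
    exact EmbCode.isMinimalCode_polarGrassmannCode_two (EmbCode.altIsotropic_span_pair hB)
      fun f g hf hg => EmbCode.exists_eq_mul_of_isAlt hB hB' hf hg
  · intro V _ _ _ Q hK hQ hn
    obtain ⟨t, ht0, ht1⟩ := EmbCode.exists_ne_zero_ne_one hK
    obtain ⟨U, hU, hr⟩ := EmbCode.exists_le_finrank_of_le_wittIndex three_ne_zero hn
    exact (EmbCode.PolarForm.ofQuadratic Q hQ ht0 ht1).isMinimalCode
      (EmbCode.quadSingular_span_pair Q) hU.ts hr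
  · intro V _ _ _ σ h hh hn
    obtain ⟨U, hU, hr⟩ := EmbCode.exists_le_finrank_of_le_wittIndex three_ne_zero hn
    exact (EmbCode.PolarForm.ofHermitian hh).isMinimalCode (EmbCode.hermIsotropic_span_pair hh)
      (fun x hx y hy => ⟨hU x hx x hx, hU x hx y hy⟩) hr
  · intro V _ _ _ n hV hn hnK
    have hd' : (∃ t : K, t ≠ 0 ∧ t ≠ 1) ∨ 4 ≤ Module.finrank K V := by
      by_cases h2 : n = 2
      · exact Or.inl (EmbCode.exists_ne_zero_ne_one fun h => hnK ⟨h2, h⟩)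
      · right; omega
    exact ⟨fun F W _ _ _ _ ε hε => EmbCode.isMinimalCode_range_embedding hε (by omega) hd',
      fun b σ => EmbCode.isMinimalCode_phSystem b σ (by omega) hd'⟩
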